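/- Let $\mathcal{M}=(S,A,P,s_0,AP,L)$ be a Markov decision process with finite sets $S$, $A$, $AP$, available-action sets $A(s)\subseteq A$, transition probabilities $P(s,a,q)\in[0,1]$ with $\sum_{q}P(s,a,q)=1$ for $a\in A(s)$, and labels $L(s)\subseteq AP$. Let $\varphi^{\mathcal S}$ (supervisor) and $\varphi^{\mathcal A}$ (agent) be co-safe LTL formulas over $AP$, represented by deterministic finite automata $\mathcal{D}_{\mathcal S}$, $\mathcal{D}_{\mathcal A}$ over the alphabet $2^{AP}$: an infinite word satisfies the formula if and only if the automaton is in an accepting state after reading some non-empty finite prefix of it. Assume moreover that acceptance by $\mathcal{D}_{\mathcal A}$ is permanent, i.e. every extension of a finite word accepted by $\mathcal{D}_{\mathcal A}$ is accepted (as is the case for the automaton accepting the good prefixes of $\varphi^{\mathcal A}$). Let $\mathcal{M}_p$ be the product of $\mathcal{M}$ with the product automaton of $\mathcal{D}_{\mathcal S}$ and $\mathcal{D}_{\mathcal A}$: its states are $(s,q^{\mathcal S},q^{\mathcal A})$, its initial state is $s_{0_p}=(s_0,\delta_{\mathcal S}(q_0^{\mathcal S},L(s_0)),\delta_{\mathcal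 A}(q_0^{\mathcal A},L(s_0)))$, the actions available at $(s,q^{\mathcal S},q^{\mathcal A})$ are $A(s)$, and action $a$ moves $(s,q^{\mathcal S},q^{\mathcal A})$ to $(s',\delta_{\mathcal S}(q^{\mathcal S},L(s')),\delta_{\mathcal A}(q^{\mathcal A},L(s')))$ with probability $P(s,a,s')$. Let $C_{\mathcal A}$ be the set of states of $\mathcal{M}_p$ whose component $q^{\mathcal A}$ is accepting. A policy on $\mathcal{M}_p$ is a sequence $\pi=\mu_0\mu_1\cdots$ of functions $\mu_t$ that assign to each state-action pair a number $\mu_t(s,a)\in[0,1]$ with $\sum_{a\in A(s)}\mu_t(s,a)=1$ for every state $s$; it is stationary if all $\mu_t$ are equal. Let $\Gamma^{\pi}_{\mathcal{M}_p}$ denote the distribution of the infinite state paths from $s_{0_p}$ under $\pi$, let $\Pr^{\pi}_{\mathcal{M}_p}(s_{0_p}\models\lozenge C_{\mathcal A})$ be the probability that the path visits $C_{\mathcal A}$, and let $KL(\cdot\,\|\,\cdot)\in[0,\infty]$ be the Kullback--Leibler divergence. Let $\pi^{\mathcal S}$ be a stationary (reference) policy on $\mathcal{M}_p$ and let $\nu^{\mathcal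 A}\in\mathbb{R}$. For every policy $\pi^{\mathcal A}$ on $\mathcal{M}_p$ with $\Pr^{\pi^{\mathcal A}}_{\mathcal{M}_p}(s_{0_p}\models\lozenge C_{\mathcal A})\ge\nu^{\mathcal A}$ there is a stationary policy $\pi^{\mathcal A,St}$ on $\mathcal{M}_p$ with $$\Pr\nolimits^{\pi^{\mathcal A,St}}_{\mathcal{M}_p}(s_{0_p}\models\lozenge C_{\mathcal A})\ge\nu^{\mathcal A} \quad\text{and}\quad KL\left(\Gamma^{\pi^{\mathcal A,St}}_{\mathcal{M}_p}\,\middle\|\,\Gamma^{\pi^{\mathcal S}}_{\mathcal{M}_p}\right)\le KL\left(\Gamma^{\pi^{\mathcal A}}_{\mathcal{M}_p}\,\middle\|\,\Gamma^{\pi^{\mathcal S}}_{\mathcal{M}_p}\right).$$ -/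

import Mathlib

open MeasureTheory ProbabilityTheory

noncomputable section

/-! ### Linear temporal logic and automata -/

/-- LTL formulas over the atomic propositions `AP`. -/
inductive LTL (AP : Type*) where
  | tru : LTL AP
  | atom : AP → LTL AP
  | neg : LTL AP → LTL AP
  | conj : LTL AP → LTL AP → LTL AP
  | disj : LTL AP → LTL AP → LTL AP
  | impl : LTL AP → LTL AP → LTL AP
  | nxt : LTL AP → LTL AP
  | ev : LTL AP → LTL AP
  | alw : LTL AP → LTL AP
  | untl : LTL AP → LTL AP → LTL AP

namespace LTL

variable {AP : Type*}

/-- `Sat φ w i`: the formula `φ` holds at position `i` of the infinite word `w` over `2 ^ AP`. -/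
def Sat : LTL AP → (ℕ → Set AP) → ℕ → Prop
  | tru, _, _ => True
  | atom p, w, i => p ∈ w i
  | neg φ, w, i => ¬ Sat φ w i
  | conj φ ψ, w, i => Sat φ w i ∧ Sat ψ w i
  | disj φ ψ, w, i => Sat φ w i ∨ Sat ψ w i
  | impl φ ψ, w, i => Sat φ w i → Sat ψ w i
  | nxt φ, w, i => Sat φ w (i + 1)
  | ev φ, w, i => ∃ j, i ≤ j ∧ Sat φ w j
  | alw φ, w, i => ∀ j, i ≤ j → Sat φ w j
  | untl φ ψ, w, i => ∃ j, i ≤ j ∧ Sat ψ w j ∧ ∀ k, i ≤ k → k < j → Sat φ w k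

/-- An infinite word satisfies a formula if the formula holds at position `0`. -/
def Models (w : ℕ → Set AP) (φ : LTL AP) : Prop := φ.Sat w 0

/-- `φ` is co-safe: every word that satisfies `φ` has a finite good prefix, that is, a finite
prefix all of whose infinite extensions satisfy `φ`. -/
def IsCoSafe (φ : LTL AP) : Prop :=
  ∀ w : ℕ → Set AP, Models w φ →
    ∃ k : ℕ, ∀ w' : ℕ → Set AP, (∀ i < k, w' i = w i) → Models w' φ

end LTL

/-- The automaton `D` represents the formula `φ`: an infinite word satisfies `φ` if and only if
`D` is in an accepting state after reading some non-empty finite prefix of it. -/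
def DFA.Represents {AP Q : Type*} (D : DFA (Set AP) Q) (φ : LTL AP) : Prop :=
  ∀ w : ℕ → Set AP,
    LTL.Models w φ ↔ ∃ k : ℕ, D.eval (List.ofFn fun i : Fin (k + 1) => w i) ∈ D.accept

/-- Acceptance is permanent: every extension of an accepted finite word is accepted. The automaton
that accepts exactly the good prefixes of a formula has this property. -/
def DFA.AcceptsPermanently {α Q : Type*} (D : DFA α Q) : Prop :=
  ∀ u v : List α, D.eval u ∈ D.accept → D.eval (u ++ v) ∈ D.accept

/-- The product of two automata over the same alphabet. -/
def DFA.pairing {α Q₁ Q₂ : Type*} (D₁ : DFA α Q₁) (D₂ : DFA α Q₂) : DFA α (Q₁ × Q₂) where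
  step q a := (D₁.step q.1 a, D₂.step q.2 a)
  start := (D₁.start, D₂.start)
  accept := D₁.accept ×ˢ D₂.accept

/-! ### Markov decision processes -/

/-- A Markov decision process with state space `S`, actions `A` and atomic propositions `AP`;
`avail s` is the set of actions that are available at `s`. -/
structure MDP (S A AP : Type*) [Fintype S] where
  avail : S → Finset A
  prob : S → A → S → ℝ
  prob_nonneg : ∀ s a q, 0 ≤ prob s a q
  prob_le_one : ∀ s a q, prob s a q ≤ 1
  prob_sum : ∀ s, ∀ a ∈ avail s, ∑ q, prob s a q = 1
  init : S
  label : S → Set AP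

namespace MDP

variable {S A AP : Type*} [Fintype S]

/-- A decision rule: a function `μ : S × A → [0, 1]` with `∑ a ∈ A(s), μ(s, a) = 1` for all `s`. -/
structure DecisionRule (M : MDP S A AP) where
  val : S → A → ℝ
  nonneg : ∀ s a, 0 ≤ val s a
  le_one : ∀ s a, val s a ≤ 1
  sum_eq_one : ∀ s, ∑ a ∈ M.avail s, val s a = 1

/-- A policy is a sequence of decision rules. -/
abbrev Policy (M : MDP S A AP) : Type _ := ℕ → M.DecisionRule

/-- A policy is stationary if it uses one and the same decision rule at all times. -/
def IsStationary (M : MDP S A AP) (π : M.Policy) : Prop :=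
  ∃ μ : M.DecisionRule, ∀ t, π t = μ

/-- The probability of moving from `s` to `q` under the decision rule `μ`. -/
def stepProb (M : MDP S A AP) (μ : M.DecisionRule) (s q : S) : ℝ :=
  ∑ a ∈ M.avail s, M.prob s a q * μ.val s a

lemma stepProb_nonneg (M : MDP S A AP) (μ : M.DecisionRule) (s q : S) :
    0 ≤ M.stepProb μ s q :=
  Finset.sum_nonneg fun a _ => mul_nonneg (M.prob_nonneg s a q) (μ.nonneg s a)

lemma stepProb_sum (M : MDP S A AP) (μ : M.DecisionRule) (s : S) :
    ∑ q, M.stepProb μ s q = 1 := by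
  unfold stepProb
  rw [Finset.sum_comm, ← μ.sum_eq_one s]
  refine Finset.sum_congr rfl fun a ha => ?_
  rw [← Finset.sum_mul, M.prob_sum s a ha, one_mul]

section Paths

variable [MeasurableSpace S] [MeasurableSingletonClass S]

/-- The one-step transition kernel of the decision rule `μ`. -/
def stepKernel (M : MDP S A AP) (μ : M.DecisionRule) : Kernel S S :=
  Kernel.ofFunOfCountable fun s =>
    ∑ q, ENNReal.ofReal (M.stepProb μ s q) • Measure.dirac q

instance instIsMarkovKernelStepKernel (M : MDP S A AP) (μ : M.DecisionRule) :
    IsMarkovKernel (M.stepKernel μ) where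
  isProbabilityMeasure s := ⟨by
    change (∑ q, ENNReal.ofReal (M.stepProb μ s q) • Measure.dirac q : Measure S) Set.univ = 1
    simp only [Measure.coe_finsetSum, Finset.sum_apply, Measure.smul_apply, measure_univ,
      smul_eq_mul, mul_one]
    rw [← ENNReal.ofReal_sum_of_nonneg fun q _ => M.stepProb_nonneg μ s q, M.stepProb_sum]
    simp⟩

/-- The transition from time `t` to time `t + 1` under the policy `π`, as a kernel on the history
up to time `t`; it depends only on the current state. -/
def historyKernel (M : MDP S A AP) (π : M.Policy) (t : ℕ) :
    Kernel ((i : Finset.Iic t) → S) S :=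
  (M.stepKernel (π t)).comap (fun h => h ⟨t, Finset.mem_Iic.2 le_rfl⟩) (measurable_pi_apply _)

instance instIsMarkovKernelHistoryKernel (M : MDP S A AP) (π : M.Policy) (t : ℕ) :
    IsMarkovKernel (M.historyKernel π t) := by
  unfold historyKernel; infer_instance

/-- The distribution of the infinite paths `s₀ s₁ s₂ …` under the policy `π`, started at the
initial state (Ionescu-Tulcea). -/
def pathDist (M : MDP S A AP) (π : M.Policy) : Measure (ℕ → S) :=
  Kernel.traj (X := fun _ => S) (M.historyKernel π) 0 (fun _ => M.init)

/-- The probability that a path under the policy `π` visits the set `C`. -/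
def reachProb (M : MDP S A AP) (π : M.Policy) (C : Set S) : ℝ :=
  (M.pathDist π).real {ξ | ∃ k, ξ k ∈ C}

end Paths

open Classical in
/-- The product of a Markov decision process and an automaton that reads its labels. -/
def product {Q : Type*} [Fintype Q] (M : MDP S A AP) (D : DFA (Set AP) Q) :
    MDP (S × Q) A Q where
  avail p := M.avail p.1
  prob p a p' := if p'.2 = D.step p.2 (M.label p'.1) then M.prob p.1 a p'.1 else 0
  prob_nonneg p a p' := by
    split_ifs
    · exact M.prob_nonneg _ _ _
    · exact le_rfl
  prob_le_one p a p' := by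
    split_ifs
    · exact M.prob_le_one _ _ _
    · exact zero_le_one
  prob_sum p a ha := by
    rw [Fintype.sum_prod_type, ← M.prob_sum p.1 a ha]
    simp
  init := (M.init, D.step D.start (M.label M.init))
  label p := {p.2}

/-- The product states in which the second (the agent's) automaton accepts. -/
def agentSet (S : Type*) {α QS QA : Type*} (DA : DFA α QA) : Set (S × QS × QA) :=
  {p | p.2.2 ∈ DA.accept}

end MDP

end

noncomputable section

/-! ### Kullback–Leibler divergence of measures on sequence spaces -/

namespace InformationTheory

open Filter Preorder
open scoped Topology ENNReal

/-! Permanent acceptance makes the agent's set closed among product states whose agent component is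
read off some word; almost every path stays among these. It remains to treat reaching a closed set
`C` in a finite MDP (`exists_stationary_reachProb_klDiv_le`).

If the divergence of the given policy `π` is infinite, only reachability matters, and some
deterministic stationary rule does at least as well as `π`
(`exists_decisionRule_forall_reachProb_le`).

If it is finite, `klDiv_pathDist` writes it as the expected sum of one-step divergences. Split the
states outside `C` into `F`, with finite expected occupation time under `π`, and `I`, with infinite.
Let `μ` average the rules of `π`, weighted by occupation, at visited states of `F`, and be the
reference rule `ρ` elsewhere, where it costs nothing. Finite divergence forces `ρ` never to leave
`I`: a transition of positive `ρ`-probability out of `I` would be taken infinitely often in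
expectation by `π`, whereas the expected flow into `C` or `F` is finite. Hence `μ` feeds `F` only
from `F`, its occupation times there are at most those of `π`, and Jensen bounds its cost. `π` does
not leave `I` either. The probability `h` of reaching `C` under `μ` then has zero total expected
drift along `π`; as `h = 1` on `C` and `h ≥ 0`, `π` reaches `C` with probability at most `h` at the
initial state. -/

lemma mul_le_klFun_of_exp_le {K x : ℝ} (hx : Real.exp (1 + K) ≤ x) : K * x ≤ klFun x := by
  have h0 : 0 < x := (Real.exp_pos _).trans_le hx
  -- The summand `1` pays for the term `-x` in `klFun x = x * log x + 1 - x`.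
  have h1 : 1 + K ≤ Real.log x := (Real.le_log_iff_exp_le h0).2 hx
  rw [klFun_apply]
  nlinarith

/-- A sequence of nonnegative functions with bounded `klFun`-entropy is uniformly integrable. -/
lemma uniformIntegrable_of_lintegral_klFun_le {Ω : Type*} {m : MeasurableSpace Ω} {ν : Measure Ω}
    [IsFiniteMeasure ν] {f : ℕ → Ω → ℝ} (hf : ∀ n, StronglyMeasurable (f n))
    (hf0 : ∀ n ω, 0 ≤ f n ω) {J : ℝ≥0∞} (hJ : J ≠ ∞)
    (h : ∀ n, ∫⁻ ω, ENNReal.ofReal (klFun (f n ω)) ∂ν ≤ J) :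
    UniformIntegrable f 1 ν := by
  refine uniformIntegrable_of' le_rfl ENNReal.one_ne_top hf fun ε hε => ?_
  -- De la Vallée-Poussin: above `exp (1 + K)` the function is at most `klFun / K`, so its tail
  -- integral is at most `J / K ≤ ε`.
  obtain ⟨K, hK, hK0⟩ : ∃ K : ℝ, J.toReal ≤ ε * K ∧ 0 < K :=
    ⟨J.toReal / ε + 1, by field_simp; linarith, by positivity⟩
  refine ⟨(Real.exp (1 + K)).toNNReal, fun n => ?_⟩
  rw [eLpNorm_one_eq_lintegral_enorm]
  have hle : ∀ ω, ‖({x | (Real.exp (1 + K)).toNNReal ≤ ‖f n x‖₊}.indicator (f n)) ω‖ₑ ≤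
      ENNReal.ofReal (1 / K) * ENNReal.ofReal (klFun (f n ω)) := by
    intro ω
    by_cases hω : ω ∈ {x | (Real.exp (1 + K)).toNNReal ≤ ‖f n x‖₊}
    · rw [Set.indicator_of_mem hω, Real.enorm_of_nonneg (hf0 n ω),
        ← ENNReal.ofReal_mul (by positivity)]
      refine ENNReal.ofReal_le_ofReal ?_
      have h1 : Real.exp (1 + K) ≤ f n ω := by
        rw [Set.mem_ofPred_eq, Real.toNNReal_le_iff_le_coe, coe_nnnorm, Real.norm_of_nonneg (hf0 n ω)] at hω
        exact hω
      have h2 := mul_le_klFun_of_exp_le h1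
      rw [one_div, inv_mul_eq_div, le_div_iff₀ hK0]
      linarith
    · rw [Set.indicator_of_notMem hω]
      simp
  calc _ ≤ ∫⁻ ω, ENNReal.ofReal (1 / K) * ENNReal.ofReal (klFun (f n ω)) ∂ν := lintegral_mono hle
    _ = ENNReal.ofReal (1 / K) * ∫⁻ ω, ENNReal.ofReal (klFun (f n ω)) ∂ν :=
      lintegral_const_mul' _ _ ENNReal.ofReal_ne_top
    _ ≤ ENNReal.ofReal (1 / K) * ENNReal.ofReal J.toReal := by
      rw [ENNReal.ofReal_toReal hJ]; gcongr; exact h n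
    _ ≤ ENNReal.ofReal ε := by
      rw [← ENNReal.ofReal_mul (by positivity)]
      refine ENNReal.ofReal_le_ofReal ?_
      rw [one_div, inv_mul_le_iff₀ hK0]
      linarith

/-- The divergence of two probability measures on a sequence space is bounded by any common bound
on the divergences of their restrictions to finitely many coordinates. -/
theorem klDiv_le_of_forall_klDiv_map_frestrictLe_le {X : Type*} [MeasurableSpace X]
    (μ ν : Measure (ℕ → X)) [IsProbabilityMeasure μ] [IsProbabilityMeasure ν] (J : ℝ≥0∞)
    (h : ∀ n : ℕ, klDiv (μ.map (frestrictLe n)) (ν.map (frestrictLe n)) ≤ J) :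
    klDiv μ ν ≤ J := by
  rcases eq_or_ne J ∞ with rfl | hJ
  · exact le_top
  have hmeas (n : ℕ) : Measurable (frestrictLe (π := fun _ : ℕ => X) n) := measurable_frestrictLe n
  have hac (n : ℕ) : μ.map (frestrictLe n) ≪ ν.map (frestrictLe n) :=
    (klDiv_ne_top_iff.1 ((h n).trans_lt hJ.lt_top).ne).1
  have hP (n : ℕ) : IsProbabilityMeasure (μ.map (frestrictLe n)) :=
    Measure.isProbabilityMeasure_map (hmeas n).aemeasurable
  have hQ (n : ℕ) : IsProbabilityMeasure (ν.map (frestrictLe n)) :=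
    Measure.isProbabilityMeasure_map (hmeas n).aemeasurable
  let ρ : (n : ℕ) → ((i : Finset.Iic n) → X) → ℝ :=
    fun n x => ((μ.map (frestrictLe n)).rnDeriv (ν.map (frestrictLe n)) x).toReal
  have hρ (n : ℕ) : Measurable (ρ n) := (Measure.measurable_rnDeriv _ _).ennreal_toReal
  let f : ℕ → (ℕ → X) → ℝ := fun n ω => ρ n (frestrictLe n ω)
  have hfm (n : ℕ) : Measurable (f n) := (hρ n).comp (hmeas n)
  have hf0 (n : ℕ) (ω) : 0 ≤ f n ω := ENNReal.toReal_nonneg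
  let ℱ : Filtration ℕ (MeasurableSpace.pi (X := fun _ : ℕ => X)) := Filtration.piLE
  have hℱ (n : ℕ) : ℱ n = MeasurableSpace.pi.comap (frestrictLe n) :=
    Filtration.piLE_eq_comap_frestrictLe n
  have hset (n : ℕ) (A : Set ((i : Finset.Iic n) → X)) (hA : MeasurableSet A) :
      ∫ ω in frestrictLe n ⁻¹' A, f n ω ∂ν = μ.real (frestrictLe n ⁻¹' A) := by
    have := setIntegral_map (μ := ν) hA (hρ n).aestronglyMeasurable (hmeas n).aemeasurable
    rw [← this, Measure.setIntegral_toReal_rnDeriv (hac n),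
      map_measureReal_apply (hmeas n) hA]
  have hint (n : ℕ) : Integrable (f n) ν :=
    (integrable_map_measure (hρ n).aestronglyMeasurable (hmeas n).aemeasurable).1
      Measure.integrable_toReal_rnDeriv
  have hadp : StronglyAdapted ℱ f := by
    intro n
    have : Measurable[ℱ n] (f n) := by
      rw [hℱ n]; exact (hρ n).comp (comap_measurable _)
    exact this.stronglyMeasurable
  -- The integral of each density over a set known at time `n` is the `μ`-mass of that set,
  -- whichever later density is used.
  have hmart : Martingale f ℱ ν := by
    refine martingale_of_setIntegral_eq_succ hadp hint fun n s hs => ?_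
    have hs' : MeasurableSet[ℱ (n + 1)] s := ℱ.mono n.le_succ _ hs
    rw [hℱ] at hs hs'
    obtain ⟨A, hA, rfl⟩ := hs
    obtain ⟨B, hB, hAB⟩ := hs'
    rw [hset n A hA, ← hAB, hset (n + 1) B hB]
  have hkl (n : ℕ) : ∫⁻ ω, ENNReal.ofReal (klFun (f n ω)) ∂ν ≤ J := by
    refine le_trans (le_of_eq ?_) (h n)
    rw [klDiv_eq_lintegral_klFun_of_ac (hac n), lintegral_map _ (hmeas n)]
    exact (measurable_klFun.comp (hρ n)).ennreal_ofReal
  have hui : UniformIntegrable f 1 ν :=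
    uniformIntegrable_of_lintegral_klFun_le (fun n => (hfm n).stronglyMeasurable) hf0 hJ hkl
  set g := Filtration.limitProcess f ℱ ν
  have hg : ∀ᵐ ω ∂ν, Tendsto (fun n => f n ω) atTop (𝓝 (g ω)) :=
    hmart.submartingale.ae_tendsto_limitProcess_of_uniformIntegrable hui
  have hg0 : 0 ≤ᵐ[ν] g := by
    filter_upwards [hg] with ω hω using ge_of_tendsto' hω fun n => hf0 n ω
  have hgint : Integrable g ν := by
    obtain ⟨R, hR⟩ := hui.2.2
    exact (Filtration.memLp_limitProcess_of_eLpNorm_bdd hui.1 hR).integrable le_rfl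
  -- Uniform integrability makes the martingale closed by `g`, so the two measures agree on
  -- cylinders, a generating π-system.
  have hμ : μ = ν.withDensity fun ω => ENNReal.ofReal (g ω) := by
    have : IsFiniteMeasure (ν.withDensity fun ω => ENNReal.ofReal (g ω)) :=
      isFiniteMeasure_withDensity_ofReal hgint.2
    have hcyl (n : ℕ) (A : Set ((i : Finset.Iic n) → X)) (hA : MeasurableSet A) :
        μ (frestrictLe n ⁻¹' A) =
          (ν.withDensity fun ω => ENNReal.ofReal (g ω)) (frestrictLe n ⁻¹' A) := by
      rw [withDensity_apply _ (hmeas n hA), ← ofReal_integral_eq_lintegral_ofReal hgint.integrableOn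
        (ae_restrict_of_ae hg0), ← setIntegral_condExp (ℱ.le n) hgint
          (by rw [hℱ]; exact ⟨A, hA, rfl⟩),
        ← integral_congr_ae (ae_restrict_of_ae (hmart.ae_eq_condExp_limitProcess hui n)),
        hset n A hA, ofReal_measureReal]
    refine ext_of_generate_finite (measurableCylinders fun _ : ℕ => X)
      generateFrom_measurableCylinders.symm isPiSystem_measurableCylinders ?_ ?_
    · intro s hs
      rw [measurableCylinders_nat] at hs
      simp only [Set.mem_iUnion, Set.mem_singleton_iff] at hs
      obtain ⟨n, A, hA, rfl⟩ := hs
      exact hcyl n A hA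
    · simpa using hcyl 0 Set.univ MeasurableSet.univ
  have hac' : μ ≪ ν := by rw [hμ]; exact withDensity_absolutelyContinuous _ _
  have hrn : ∀ᵐ ω ∂ν, (μ.rnDeriv ν ω).toReal = g ω := by
    have h1 := Measure.rnDeriv_withDensity₀ ν (f := fun ω => ENNReal.ofReal (g ω))
      hgint.1.aemeasurable.ennreal_ofReal
    rw [← hμ] at h1
    filter_upwards [h1, hg0] with ω hω h0
    rw [hω, ENNReal.toReal_ofReal h0]
  rw [klDiv_eq_lintegral_klFun_of_ac hac']
  -- Fatou, with continuity of `klFun` along the almost surely convergent densities.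
  calc ∫⁻ ω, ENNReal.ofReal (klFun (μ.rnDeriv ν ω).toReal) ∂ν
      ≤ ∫⁻ ω, liminf (fun n => ENNReal.ofReal (klFun (f n ω))) atTop ∂ν := by
        refine lintegral_mono_ae ?_
        filter_upwards [hrn, hg] with ω h1 h2
        rw [h1]
        exact (((ENNReal.continuous_ofReal.comp continuous_klFun).tendsto _).comp h2).liminf_eq.ge
    _ ≤ liminf (fun n => ∫⁻ ω, ENNReal.ofReal (klFun (f n ω)) ∂ν) atTop :=
        lintegral_liminf_le fun n => (measurable_klFun.comp (hfm n)).ennreal_ofReal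
    _ ≤ J := liminf_le_of_le (by isBoundedDefault) fun b hb => by
        obtain ⟨n, hn⟩ := hb.exists
        exact hn.trans (hkl n)

end InformationTheory

/-! ### Divergence on finite spaces -/

namespace InformationTheory

open scoped ENNReal

/-- The contribution of an atom of masses `a` and `b` to the Kullback–Leibler divergence. -/
def klAtom (a b : ℝ) : ℝ≥0∞ :=
  if b = 0 then (if a = 0 then 0 else ∞) else ENNReal.ofReal (b * klFun (a / b))

lemma klAtom_zero_right {a : ℝ} (ha : a ≠ 0) : klAtom a 0 = ∞ := by simp [klAtom, ha]

lemma klAtom_self (a : ℝ) : klAtom a a = 0 := by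
  unfold klAtom
  split_ifs with h
  · rfl
  · simp [div_self h, klFun_one]

lemma klAtom_of_ne_zero (a : ℝ) {b : ℝ} (hb : b ≠ 0) :
    klAtom a b = ENNReal.ofReal (b * klFun (a / b)) := if_neg hb

/-- Joint homogeneity lets the mass of a history factor out of the contribution of its one-step
extensions. -/
lemma klAtom_mul_left {m : ℝ} (hm : 0 ≤ m) (a b : ℝ) :
    klAtom (m * a) (m * b) = ENNReal.ofReal m * klAtom a b := by
  rcases hm.eq_or_lt with rfl | hm
  · simp [klAtom]
  · unfold klAtom
    simp only [mul_eq_zero, hm.ne', false_or]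
    split_ifs
    · simp
    · rw [ENNReal.mul_top (by simpa using hm)]
    · rw [← ENNReal.ofReal_mul hm.le, mul_div_mul_left _ _ hm.ne', mul_assoc]

lemma klDiv_eq_sum_klAtom {Ω : Type*} [Fintype Ω] [MeasurableSpace Ω] [MeasurableSingletonClass Ω]
    (P Q : Measure Ω) [IsFiniteMeasure P] [IsFiniteMeasure Q] :
    klDiv P Q = ∑ z, klAtom (P.real {z}) (Q.real {z}) := by
  by_cases hac : P ≪ Q
  · rw [klDiv_eq_lintegral_klFun_of_ac hac, lintegral_fintype]
    refine Finset.sum_congr rfl fun z _ => ?_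
    have h1 : P.rnDeriv Q z * Q {z} = P {z} := by
      conv_rhs => rw [← Measure.withDensity_rnDeriv_eq P Q hac]
      rw [withDensity_apply _ (measurableSet_singleton z), lintegral_singleton]
    have h2 : P.real {z} = (P.rnDeriv Q z).toReal * Q.real {z} := by
      rw [measureReal_def, ← h1, ENNReal.toReal_mul, measureReal_def]
    by_cases hz : Q.real {z} = 0
    · have : Q {z} = 0 := (measureReal_eq_zero_iff (by finiteness)).1 hz
      rw [h2, hz, this]
      simp [klAtom]
    · rw [klAtom_of_ne_zero _ hz, h2, mul_div_cancel_right₀ _ hz,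
        ENNReal.ofReal_mul measureReal_nonneg, ofReal_measureReal, mul_comm]
  · rw [klDiv_of_not_ac hac]
    obtain ⟨z, hz1, hz2⟩ : ∃ z, Q {z} = 0 ∧ P {z} ≠ 0 := by
      by_contra! hcon
      refine hac (Measure.AbsolutelyContinuous.mk fun s _ hs => ?_)
      rw [← Set.biUnion_of_singleton s, measure_biUnion_null_iff (Set.to_countable s)]
      exact fun z hz => hcon z (measure_mono_null (Set.singleton_subset_iff.2 hz) hs)
    symm
    rw [ENNReal.sum_eq_top]
    refine ⟨z, Finset.mem_univ z, ?_⟩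
    rw [measureReal_def Q, hz1, ENNReal.toReal_zero, klAtom_zero_right]
    rwa [Ne, measureReal_eq_zero_iff (by finiteness)]

/-- The graph of `klFun` lies above its tangents. -/
lemma klFun_add_log_mul_le {a c : ℝ} (ha : 0 ≤ a) (hc : 0 < c) :
    klFun c + Real.log c * (a - c) ≤ klFun a := by
  -- The gap between `klFun` and its tangent at `c` is itself `c * klFun (a / c)`.
  have h := mul_nonneg hc.le (klFun_nonneg (div_nonneg ha hc.le))
  have : c * klFun (a / c) = klFun a - (klFun c + Real.log c * (a - c)) := by
    rcases ha.eq_or_lt with rfl | ha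
    · simp [klFun_apply]; ring
    · simp only [klFun_apply, Real.log_div ha.ne' hc.ne']
      field_simp
      ring
  linarith

/-- The tangent of `klFun` at `1 / 2` gives `klFun u ≥ 1 / 2 - u * log 2 ≥ 1 / 2 - u`. Summed over
time, this bounds the flow under the reference rule by the cost and the actual flow. -/
lemma ofReal_le_two_mul_klAtom_add {a b : ℝ} (ha : 0 ≤ a) (hb : 0 ≤ b) :
    ENNReal.ofReal b ≤ 2 * (klAtom a b + ENNReal.ofReal a) := by
  rcases hb.eq_or_lt with rfl | hb
  · simp
  have h := klFun_add_log_mul_le (div_nonneg ha hb.le) (c := 1 / 2) (by norm_num)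
  have hlog : Real.log (1 / 2) = - Real.log 2 := by rw [one_div, Real.log_inv]
  have hlog2 : Real.log 2 ≤ 1 := by linarith [Real.log_two_lt_d9]
  have h2 : 1 / 2 - a / b ≤ klFun (a / b) := by
    rw [klFun_apply (1 / 2), hlog] at h
    nlinarith [div_nonneg ha hb.le]
  have h3 : b / 2 - a ≤ b * klFun (a / b) := by
    have := mul_le_mul_of_nonneg_left h2 hb.le
    rwa [mul_sub, mul_div_cancel₀ _ hb.ne', mul_one_div] at this
  rw [klAtom_of_ne_zero _ hb.ne', ← ENNReal.ofReal_add
      (mul_nonneg hb.le (klFun_nonneg (div_nonneg ha hb.le))) ha, ← ENNReal.ofReal_ofNat 2,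
    ← ENNReal.ofReal_mul (by norm_num)]
  exact ENNReal.ofReal_le_ofReal (by linarith)

/-- Countable Jensen inequality for the divergence contributions of an atom. -/
lemma ofReal_mul_klAtom_le_tsum {w a : ℕ → ℝ} {W c b : ℝ} (hw : ∀ t, 0 ≤ w t) (ha : ∀ t, 0 ≤ a t)
    (hb : 0 ≤ b) (hW : HasSum w W) (hW0 : 0 < W) (hc : HasSum (fun t => w t * a t) (W * c)) :
    ENNReal.ofReal W * klAtom c b ≤ ∑' t, ENNReal.ofReal (w t) * klAtom (a t) b := by
  have hc0 : 0 ≤ c := by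
    have := hc.nonneg fun t => mul_nonneg (hw t) (ha t)
    exact nonneg_of_mul_nonneg_right this hW0
  have hzero (h : c = 0) (t : ℕ) : w t = 0 ∨ a t = 0 := by
    rw [h, mul_zero, hasSum_zero_iff_of_nonneg fun t => mul_nonneg (hw t) (ha t)] at hc
    simpa using congrFun hc t
  rcases hb.eq_or_lt with rfl | hb
  · by_cases hc' : c = 0
    · simp [klAtom, hc']
    · obtain ⟨t, ht⟩ : ∃ t, w t * a t ≠ 0 := by
        by_contra! h
        refine hc' ?_
        simp only [h] at hc
        have := hc.unique hasSum_zero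
        simpa [hW0.ne'] using this
      have hwt := left_ne_zero_of_mul ht
      refine le_trans le_top (le_trans (le_of_eq ?_) (ENNReal.le_tsum t))
      rw [klAtom_zero_right (right_ne_zero_of_mul ht), ENNReal.mul_top]
      simpa using lt_of_le_of_ne (hw t) hwt.symm
  · by_cases hfin : ∑' t, ENNReal.ofReal (w t) * klAtom (a t) b = ∞
    · rw [hfin]; exact le_top
    have hterm (t : ℕ) : ENNReal.ofReal (w t) * klAtom (a t) b =
        ENNReal.ofReal (w t * (b * klFun (a t / b))) := by
      rw [klAtom_of_ne_zero _ hb.ne', ENNReal.ofReal_mul (hw t)]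
    have hnn (t : ℕ) : 0 ≤ w t * (b * klFun (a t / b)) :=
      mul_nonneg (hw t) (mul_nonneg hb.le (klFun_nonneg (div_nonneg (ha t) hb.le)))
    simp only [hterm] at hfin ⊢
    have hs : Summable fun t => w t * (b * klFun (a t / b)) := by
      have := ENNReal.summable_toReal hfin
      simpa only [ENNReal.toReal_ofReal (hnn _)] using this
    rw [← ENNReal.ofReal_tsum_of_nonneg hnn hs, klAtom_of_ne_zero _ hb.ne',
      ← ENNReal.ofReal_mul hW0.le]
    refine ENNReal.ofReal_le_ofReal ?_
    -- At `c = 0` there is no finite tangent; but then every term has weight or value zero, and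
    -- equality holds.
    rcases hc0.eq_or_lt with h | hcpos
    · have : HasSum (fun t => w t * (b * klFun (a t / b))) (W * (b * klFun (c / b))) := by
        refine (hW.mul_right (b * klFun (c / b))).congr_fun fun t => ?_
        rcases hzero h.symm t with h0 | h0 <;> simp [h0, ← h]
      exact this.tsum_eq.ge
    · have hcb : 0 < c / b := div_pos hcpos hb
      -- The tangent at the mean `c / b`, summed with weights `w`: the linear part cancels.
      have h1 : HasSum (fun t => w t * (b * klFun (c / b) - Real.log (c / b) * c) +
          Real.log (c / b) * (w t * a t)) (W * (b * klFun (c / b))) := by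
        have := (hW.mul_right (b * klFun (c / b) - Real.log (c / b) * c)).add
          (hc.mul_left (Real.log (c / b)))
        rwa [show W * (b * klFun (c / b) - Real.log (c / b) * c) + Real.log (c / b) * (W * c) =
          W * (b * klFun (c / b)) by ring] at this
      refine hasSum_le (fun t => ?_) h1 hs.hasSum
      have h2 := mul_le_mul_of_nonneg_left
        (mul_le_mul_of_nonneg_left (klFun_add_log_mul_le (div_nonneg (ha t) hb.le) hcb) hb.le)
        (hw t)
      refine le_trans (le_of_eq ?_) h2
      field_simp
      ring

end InformationTheory

/-! ### Path distributions of Markov decision processes -/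

namespace MDP

open Filter Preorder InformationTheory
open scoped Topology ENNReal

variable {S A AP : Type*} [Fintype S]

open Classical in
/-- The distribution of the state at a given time under a policy. -/
def marginal (M : MDP S A AP) (π : M.Policy) : ℕ → S → ℝ
  | 0, x => if x = M.init then 1 else 0
  | n + 1, y => ∑ x, marginal M π n x * M.stepProb (π n) x y

/-- The divergence of the transition probabilities of two decision rules at a state. -/
def stepCost (M : MDP S A AP) (μ ρ : M.DecisionRule) (x : S) : ℝ≥0∞ :=
  ∑ y, klAtom (M.stepProb μ x y) (M.stepProb ρ x y)

/-- A set of states that no available action can leave. -/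
def IsClosedSet (M : MDP S A AP) (C : Set S) : Prop :=
  ∀ x ∈ C, ∀ a ∈ M.avail x, ∀ y ∉ C, M.prob x a y = 0

lemma IsClosedSet.stepProb_eq_zero {M : MDP S A AP} {C : Set S} (hC : M.IsClosedSet C)
    (μ : M.DecisionRule) {x y : S} (hx : x ∈ C) (hy : y ∉ C) : M.stepProb μ x y = 0 :=
  Finset.sum_eq_zero fun a ha => by rw [hC x hx a ha y hy, zero_mul]

lemma marginal_nonneg (M : MDP S A AP) (π : M.Policy) (n : ℕ) (x : S) : 0 ≤ M.marginal π n x := by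
  induction n generalizing x with
  | zero => unfold marginal; split_ifs <;> simp
  | succ n ih => exact Finset.sum_nonneg fun y _ => mul_nonneg (ih y) (M.stepProb_nonneg _ _ _)

lemma marginal_succ (M : MDP S A AP) (π : M.Policy) (n : ℕ) (y : S) :
    M.marginal π (n + 1) y = ∑ x, M.marginal π n x * M.stepProb (π n) x y := rfl

lemma sum_marginal_zero_mul (M : MDP S A AP) (π : M.Policy) (h : S → ℝ) :
    ∑ x, M.marginal π 0 x * h x = h M.init := by
  rw [Finset.sum_eq_single M.init] <;> simp +contextual [marginal]

lemma sum_marginal_succ_mul (M : MDP S A AP) (π : M.Policy) (n : ℕ) (h : S → ℝ) :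
    ∑ y, M.marginal π (n + 1) y * h y =
      ∑ x, M.marginal π n x * ∑ y, M.stepProb (π n) x y * h y := by
  simp only [marginal_succ, Finset.sum_mul, Finset.mul_sum, mul_assoc]
  exact Finset.sum_comm

lemma sum_marginal (M : MDP S A AP) (π : M.Policy) (n : ℕ) : ∑ x, M.marginal π n x = 1 := by
  induction n with
  | zero => simpa using M.sum_marginal_zero_mul π fun _ => 1
  | succ n ih =>
    have := M.sum_marginal_succ_mul π n fun _ => 1
    simpa [M.stepProb_sum, ih] using this

section Paths

variable [MeasurableSpace S] [MeasurableSingletonClass S]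

instance isProbabilityMeasure_pathDist (M : MDP S A AP) (π : M.Policy) :
    IsProbabilityMeasure (M.pathDist π) := by
  unfold pathDist; infer_instance

lemma stepKernel_real_singleton (M : MDP S A AP) (μ : M.DecisionRule) (x y : S) :
    (M.stepKernel μ x).real {y} = M.stepProb μ x y := by
  classical
  rw [measureReal_def]
  change ((∑ q, ENNReal.ofReal (M.stepProb μ x q) • Measure.dirac q : Measure S) {y}).toReal = _
  simp [Measure.coe_finsetSum, Set.indicator_apply,
    ENNReal.toReal_ofReal (M.stepProb_nonneg μ x y)]

lemma map_frestrictLe_prodMk_pathDist (M : MDP S A AP) (π : M.Policy) (n : ℕ) :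
    (M.pathDist π).map (fun ξ => (frestrictLe n ξ, ξ (n + 1))) =
      (M.pathDist π).map (frestrictLe n) ⊗ₘ M.historyKernel π n := by
  have h1 : (M.pathDist π).map (frestrictLe n) =
      Kernel.partialTraj (X := fun _ => S) (M.historyKernel π) 0 n (fun _ => M.init) :=
    Kernel.traj_map_frestrictLe_apply 0 n _
  rw [h1]
  exact (Kernel.partialTraj_compProd_eq_map_traj (X := fun _ => S) (κ := M.historyKernel π)
    (Nat.zero_le n) (x₀ := fun _ => M.init)).symm

/-- The Markov property: `historyKernel` sees only the last coordinate of the history. -/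
lemma pathDist_real_pair (M : MDP S A AP) (π : M.Policy) (n : ℕ) (x y : S) :
    (M.pathDist π).real {ξ | ξ n = x ∧ ξ (n + 1) = y} =
      (M.pathDist π).real {ξ | ξ n = x} * M.stepProb (π n) x y := by
  let B : Set ((i : Finset.Iic n) → S) := {h | h ⟨n, Finset.mem_Iic.2 le_rfl⟩ = x}
  have hB : MeasurableSet B := MeasurableSet.of_discrete
  have hm : Measurable (fun ξ : ℕ → S => (frestrictLe (π := fun _ => S) n ξ, ξ (n + 1))) := by
    fun_prop
  have h1 : {ξ : ℕ → S | ξ n = x ∧ ξ (n + 1) = y} =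
      (fun ξ : ℕ → S => (frestrictLe (π := fun _ => S) n ξ, ξ (n + 1))) ⁻¹' (B ×ˢ {y}) := rfl
  have h2 : {ξ : ℕ → S | ξ n = x} = frestrictLe (π := fun _ => S) n ⁻¹' B := rfl
  have h3 : ∀ h ∈ B, M.historyKernel π n h {y} = M.stepKernel (π n) x {y} := by
    intro h hh
    rw [← show h ⟨n, Finset.mem_Iic.2 le_rfl⟩ = x from hh]
    rfl
  rw [h1, ← map_measureReal_apply hm (hB.prod (measurableSet_singleton y)),
    map_frestrictLe_prodMk_pathDist, measureReal_def,
    Measure.compProd_apply_prod hB (measurableSet_singleton y), setLIntegral_congr_fun hB h3,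
    setLIntegral_const, ENNReal.toReal_mul, h2, ← stepKernel_real_singleton, mul_comm,
    Measure.map_apply (by fun_prop) hB]
  rfl

lemma pathDist_real_eval (M : MDP S A AP) (π : M.Policy) (n : ℕ) (x : S) :
    (M.pathDist π).real {ξ | ξ n = x} = M.marginal π n x := by
  classical
  induction n generalizing x with
  | zero =>
    have h1 : (M.pathDist π).map (frestrictLe 0) = Measure.dirac (fun _ => M.init) := by
      have h1 : (M.pathDist π).map (frestrictLe 0) =
          Kernel.partialTraj (X := fun _ => S) (M.historyKernel π) 0 0 (fun _ => M.init) :=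
        Kernel.traj_map_frestrictLe_apply 0 0 _
      rw [h1, Kernel.partialTraj_self, Kernel.id_apply]
    have h2 : {ξ : ℕ → S | ξ 0 = x} = frestrictLe (π := fun _ => S) 0 ⁻¹'
      {h | h ⟨0, Finset.mem_Iic.2 le_rfl⟩ = x} := rfl
    rw [h2, ← map_measureReal_apply (by fun_prop) MeasurableSet.of_discrete, h1, measureReal_def,
      Measure.dirac_apply' _ MeasurableSet.of_discrete]
    by_cases h : x = M.init
    · simp [marginal, h]
    · simp [marginal, h, Ne.symm h]
  | succ n ih =>
    have h1 : {ξ : ℕ → S | ξ (n + 1) = x} = ⋃ y, {ξ | ξ n = y ∧ ξ (n + 1) = x} := by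
      ext ξ; simp
    rw [h1, measureReal_iUnion_fintype]
    · simp only [pathDist_real_pair, ih, marginal_succ]
    · intro y z hyz
      refine Set.disjoint_left.2 fun ξ h2 h3 => hyz (h2.1.symm.trans h3.1)
    · exact fun y => (measurableSet_eq_fun (by fun_prop) (by fun_prop)).inter
        (measurableSet_eq_fun (by fun_prop) (by fun_prop))

lemma pathDist_eval_mem (M : MDP S A AP) (π : M.Policy) (n : ℕ) (C : Set S) [DecidablePred (· ∈ C)] :
    (M.pathDist π).real {ξ | ξ n ∈ C} = ∑ x, if x ∈ C then M.marginal π n x else 0 := by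
  have h1 : {ξ : ℕ → S | ξ n ∈ C} = ⋃ x ∈ Finset.univ.filter (· ∈ C), {ξ | ξ n = x} := by
    ext ξ; simp
  rw [h1, measureReal_biUnion_finset, ← Finset.sum_filter]
  · exact Finset.sum_congr rfl fun x _ => M.pathDist_real_eval π n x
  · intro y _ z _ hyz
    exact Set.disjoint_left.2 fun ξ h2 h3 => hyz (h2.symm.trans h3)
  · exact fun y _ => measurableSet_eq_fun (by fun_prop) (by fun_prop)

lemma ae_mem_of_mem (M : MDP S A AP) (π : M.Policy) {C : Set S} (hC : M.IsClosedSet C) :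
    ∀ᵐ ξ ∂M.pathDist π, ∀ n, ξ n ∈ C → ξ (n + 1) ∈ C := by
  rw [ae_all_iff]
  intro n
  rw [ae_iff]
  have h1 : {ξ : ℕ → S | ¬ (ξ n ∈ C → ξ (n + 1) ∈ C)} ⊆
      ⋃ x : C, ⋃ y : (Cᶜ : Set S), {ξ | ξ n = x ∧ ξ (n + 1) = y} := by
    intro ξ hξ
    simp only [Set.mem_ofPred_eq, Classical.not_imp] at hξ
    simp [hξ]
  refine measure_mono_null h1 ?_
  simp only [measure_iUnion_null_iff]
  rintro ⟨x, hx⟩ ⟨y, hy⟩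
  rw [← measureReal_eq_zero_iff (by finiteness), pathDist_real_pair,
    hC.stepProb_eq_zero _ hx hy, mul_zero]

lemma ae_init (M : MDP S A AP) (π : M.Policy) : ∀ᵐ ξ ∂M.pathDist π, ξ 0 = M.init := by
  have h := M.pathDist_real_eval π 0 M.init
  rw [marginal, if_pos rfl] at h
  rw [ae_iff, ← measureReal_eq_zero_iff (by finiteness)]
  have := probReal_compl_eq_one_sub (μ := M.pathDist π) (s := {ξ | ξ 0 = M.init})
    (measurableSet_eq_fun (by fun_prop) (by fun_prop))
  rw [h, sub_self] at this
  exact this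

lemma ae_forall_mem (M : MDP S A AP) (π : M.Policy) {G : Set S} (hG : M.IsClosedSet G)
    (h0 : M.init ∈ G) : ∀ᵐ ξ ∂M.pathDist π, ∀ n, ξ n ∈ G := by
  filter_upwards [M.ae_mem_of_mem π hG, M.ae_init π] with ξ h1 h2 n
  induction n with
  | zero => rwa [h2]
  | succ n ih => exact h1 n ih

/-- Permanence of acceptance gives closedness only at reachable automaton states; this removes the
restriction to them. -/
lemma reachProb_inter (M : MDP S A AP) (π : M.Policy) {C G : Set S} (hG : M.IsClosedSet G)
    (h0 : M.init ∈ G) : M.reachProb π (C ∩ G) = M.reachProb π C := by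
  refine measureReal_congr ?_
  filter_upwards [M.ae_forall_mem π hG h0] with ξ hξ
  refine propext (exists_congr fun n => ?_)
  simp [hξ n]

/-- The probability of being in a closed set of states at time `n` tends to that of reaching it. -/
lemma tendsto_reachProb (M : MDP S A AP) (π : M.Policy) {C : Set S} (hC : M.IsClosedSet C)
    [DecidablePred (· ∈ C)] :
    Tendsto (fun n => ∑ x, if x ∈ C then M.marginal π n x else 0) atTop (𝓝 (M.reachProb π C)) := by
  simp only [← pathDist_eval_mem]
  have h1 : Tendsto (fun n => (M.pathDist π).real {ξ | ∃ k ≤ n, ξ k ∈ C}) atTop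
      (𝓝 (M.reachProb π C)) := by
    have h := tendsto_measure_iUnion_atTop (μ := M.pathDist π)
      (s := fun n => {ξ : ℕ → S | ∃ k ≤ n, ξ k ∈ C}) fun m n hmn ξ ⟨k, hk, hξ⟩ =>
        ⟨k, hk.trans hmn, hξ⟩
    have h2 : (⋃ n, {ξ : ℕ → S | ∃ k ≤ n, ξ k ∈ C}) = {ξ | ∃ k, ξ k ∈ C} := by
      ext ξ
      simp only [Set.mem_iUnion, Set.mem_ofPred_eq]
      exact ⟨fun ⟨_, k, _, h⟩ => ⟨k, h⟩, fun ⟨k, h⟩ => ⟨k, k, le_rfl, h⟩⟩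
    rw [h2] at h
    exact (ENNReal.tendsto_toReal (by finiteness)).comp h
  -- Almost surely, having visited a closed set by time `n` is the same as being in it at time `n`.
  refine h1.congr fun n => measureReal_congr ?_
  filter_upwards [M.ae_mem_of_mem π hC] with ξ hξ
  have hmono (k m : ℕ) (hkm : k ≤ m) (h : ξ k ∈ C) : ξ m ∈ C := by
    induction m, hkm using Nat.le_induction with
    | base => exact h
    | succ m _ ih => exact hξ m ih
  exact propext ⟨fun ⟨k, hk, h⟩ => hmono k n hk h, fun h => ⟨n, le_rfl, h⟩⟩

/-- The chain rule: the conditional term compares two kernels under the history law of `π`, and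
depends on the history only through its last state. -/
lemma klDiv_map_frestrictLe_succ (M : MDP S A AP) (π ρ : M.Policy) (n : ℕ) :
    klDiv ((M.pathDist π).map (frestrictLe (n + 1))) ((M.pathDist ρ).map (frestrictLe (n + 1))) =
      klDiv ((M.pathDist π).map (frestrictLe n)) ((M.pathDist ρ).map (frestrictLe n)) +
        ∑ x, ENNReal.ofReal (M.marginal π n x) * M.stepCost (π n) (ρ n) x := by
  classical
  let u : (ℕ → S) → ((i : Finset.Iic n) → S) × S := fun ξ => (frestrictLe n ξ, ξ (n + 1))
  have hu : Measurable u := by unfold u; fun_prop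
  let e : ((i : Finset.Iic (n + 1)) → S) → ((i : Finset.Iic n) → S) × S :=
    fun h => (fun i => h ⟨i, Finset.mem_Iic.2 ((Finset.mem_Iic.1 i.2).trans n.le_succ)⟩,
      h ⟨n + 1, Finset.mem_Iic.2 le_rfl⟩)
  let e' : ((i : Finset.Iic n) → S) × S → ((i : Finset.Iic (n + 1)) → S) :=
    fun p i => if hi : i.1 ≤ n then p.1 ⟨i, Finset.mem_Iic.2 hi⟩ else p.2
  have he : e ∘ frestrictLe (π := fun _ => S) (n + 1) = u := rfl
  have he' : e' ∘ u = frestrictLe (π := fun _ => S) (n + 1) := by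
    ext ξ ⟨i, hi⟩
    simp only [Function.comp_apply, e', u, frestrictLe_apply]
    split_ifs with h
    · rfl
    · rw [show i = n + 1 by have := Finset.mem_Iic.1 hi; omega]
  have hem : Measurable e := Measurable.of_discrete
  have hem' : Measurable e' := Measurable.of_discrete
  have h1 : klDiv ((M.pathDist π).map (frestrictLe (n + 1)))
      ((M.pathDist ρ).map (frestrictLe (n + 1))) =
        klDiv ((M.pathDist π).map u) ((M.pathDist ρ).map u) := by
    -- `e` and `e'` only regroup coordinates; data processing in both directions gives equality.
    refine le_antisymm ?_ ?_
    · rw [← he', ← Measure.map_map hem' hu, ← Measure.map_map hem' hu]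
      have := Measure.isProbabilityMeasure_map (μ := M.pathDist π) hu.aemeasurable
      have := Measure.isProbabilityMeasure_map (μ := M.pathDist ρ) hu.aemeasurable
      exact klDiv_map_le _ _ hem'
    · rw [← he, ← Measure.map_map hem (by fun_prop), ← Measure.map_map hem (by fun_prop)]
      have := Measure.isProbabilityMeasure_map (μ := M.pathDist π)
        (measurable_frestrictLe (n + 1)).aemeasurable
      have := Measure.isProbabilityMeasure_map (μ := M.pathDist ρ)
        (measurable_frestrictLe (n + 1)).aemeasurable
      exact klDiv_map_le _ _ hem
  have i1 := Measure.isProbabilityMeasure_map (μ := M.pathDist π)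
    (measurable_frestrictLe n).aemeasurable
  have i2 := Measure.isProbabilityMeasure_map (μ := M.pathDist ρ)
    (measurable_frestrictLe n).aemeasurable
  rw [h1, map_frestrictLe_prodMk_pathDist, map_frestrictLe_prodMk_pathDist, klDiv_compProd_eq_add]
  congr 1
  let l : Finset.Iic n := ⟨n, Finset.mem_Iic.2 le_rfl⟩
  have hatom (σ : M.Policy) (h : (i : Finset.Iic n) → S) (y : S) :
      ((M.pathDist π).map (frestrictLe n) ⊗ₘ M.historyKernel σ n).real {(h, y)} =
        ((M.pathDist π).map (frestrictLe n)).real {h} * M.stepProb (σ n) (h l) y := by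
    rw [← Set.singleton_prod_singleton, measureReal_def, Measure.compProd_apply_prod
      (measurableSet_singleton h) (measurableSet_singleton y), lintegral_singleton,
      ENNReal.toReal_mul, ← stepKernel_real_singleton, mul_comm]
    rfl
  rw [klDiv_eq_sum_klAtom, Fintype.sum_prod_type]
  simp only [hatom, klAtom_mul_left measureReal_nonneg, ← Finset.mul_sum]
  have h0 (h : (i : Finset.Iic n) → S) :
      ENNReal.ofReal (((M.pathDist π).map (frestrictLe n)).real {h}) =
        (M.pathDist π).map (frestrictLe n) {h} := ofReal_measureReal
  simp only [h0]
  change ∑ h, ((M.pathDist π).map (frestrictLe n)) {h} * M.stepCost (π n) (ρ n) (h l) = _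
  have h2 : ∑ h, ((M.pathDist π).map (frestrictLe n)) {h} * M.stepCost (π n) (ρ n) (h l) =
      ∫⁻ h, M.stepCost (π n) (ρ n) (h l) ∂((M.pathDist π).map (frestrictLe n)) := by
    rw [lintegral_fintype]
    simp only [mul_comm]
  have h3 : ∀ x, ((M.pathDist π).map fun ξ => ξ n) {x} = ENNReal.ofReal (M.marginal π n x) := by
    intro x
    rw [← pathDist_real_eval, ofReal_measureReal, Measure.map_apply (by fun_prop)
      (measurableSet_singleton x)]
    rfl
  rw [h2, lintegral_map Measurable.of_discrete (by fun_prop)]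
  change ∫⁻ ξ, M.stepCost (π n) (ρ n) (ξ n) ∂(M.pathDist π) = _
  rw [← lintegral_map (f := M.stepCost (π n) (ρ n)) (g := fun ξ : ℕ → S => ξ n)
    Measurable.of_discrete (by fun_prop), lintegral_fintype]
  simp only [h3, mul_comm]

lemma klDiv_map_frestrictLe (M : MDP S A AP) (π ρ : M.Policy) (n : ℕ) :
    klDiv ((M.pathDist π).map (frestrictLe n)) ((M.pathDist ρ).map (frestrictLe n)) =
      ∑ t ∈ Finset.range n,
        ∑ x, ENNReal.ofReal (M.marginal π t x) * M.stepCost (π t) (ρ t) x := by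
  induction n with
  | zero =>
    have h (σ : M.Policy) : (M.pathDist σ).map (frestrictLe 0) =
        Measure.dirac (fun _ => M.init) := by
      have h1 : (M.pathDist σ).map (frestrictLe 0) =
          Kernel.partialTraj (X := fun _ => S) (M.historyKernel σ) 0 0 (fun _ => M.init) :=
        Kernel.traj_map_frestrictLe_apply 0 0 _
      rw [h1, Kernel.partialTraj_self, Kernel.id_apply]
    rw [h, h, klDiv_self, Finset.range_zero, Finset.sum_empty]
  | succ n ih => rw [klDiv_map_frestrictLe_succ, ih, Finset.sum_range_succ]

/-- The divergence of the path distributions is the expected sum of the divergences of the steps. -/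
lemma klDiv_pathDist (M : MDP S A AP) (π ρ : M.Policy) :
    klDiv (M.pathDist π) (M.pathDist ρ) =
      ∑' t, ∑ x, ENNReal.ofReal (M.marginal π t x) * M.stepCost (π t) (ρ t) x := by
  refine le_antisymm ?_ ?_
  · refine klDiv_le_of_forall_klDiv_map_frestrictLe_le _ _ _ fun n => ?_
    rw [klDiv_map_frestrictLe]
    exact ENNReal.sum_le_tsum _
  · rw [ENNReal.tsum_eq_iSup_nat]
    refine iSup_le fun n => ?_
    rw [← klDiv_map_frestrictLe]
    exact klDiv_map_le _ _ (measurable_frestrictLe n)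

end Paths

end MDP

/-! ### Reachability under stationary policies -/

namespace MDP

open Filter
open scoped Topology ENNReal

variable {S A AP : Type*} [Fintype S]

open Classical in
/-- The probability of being in `C` after a given number of steps under a stationary policy, as a
function of the initial state. -/
def hitProb (M : MDP S A AP) (μ : M.DecisionRule) (C : Set S) : ℕ → S → ℝ
  | 0, x => if x ∈ C then 1 else 0
  | n + 1, x => ∑ y, M.stepProb μ x y * hitProb M μ C n y

lemma hitProb_succ (M : MDP S A AP) (μ : M.DecisionRule) (C : Set S) (n : ℕ) (x : S) :
    M.hitProb μ C (n + 1) x = ∑ y, M.stepProb μ x y * M.hitProb μ C n y := rfl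

lemma hitProb_nonneg (M : MDP S A AP) (μ : M.DecisionRule) (C : Set S) (n : ℕ) (x : S) :
    0 ≤ M.hitProb μ C n x := by
  induction n generalizing x with
  | zero => unfold hitProb; split_ifs <;> simp
  | succ n ih => exact Finset.sum_nonneg fun y _ => mul_nonneg (M.stepProb_nonneg _ _ _) (ih y)

lemma hitProb_le_one (M : MDP S A AP) (μ : M.DecisionRule) (C : Set S) (n : ℕ) (x : S) :
    M.hitProb μ C n x ≤ 1 := by
  induction n generalizing x with
  | zero => unfold hitProb; split_ifs <;> simp
  | succ n ih =>
    rw [← M.stepProb_sum μ x]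
    exact Finset.sum_le_sum fun y _ => mul_le_of_le_one_right (M.stepProb_nonneg _ _ _) (ih y)

lemma hitProb_of_mem {M : MDP S A AP} {C : Set S} (hC : M.IsClosedSet C) (μ : M.DecisionRule)
    (n : ℕ) {x : S} (hx : x ∈ C) : M.hitProb μ C n x = 1 := by
  induction n generalizing x with
  | zero => simp [hitProb, hx]
  | succ n ih =>
    rw [hitProb_succ, ← M.stepProb_sum μ x]
    refine Finset.sum_congr rfl fun y _ => ?_
    by_cases hy : y ∈ C
    · rw [ih hy, mul_one]
    · rw [hC.stepProb_eq_zero μ hx hy, zero_mul]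

lemma hitProb_of_forall_stepProb_eq_zero {M : MDP S A AP} {C I : Set S} {μ : M.DecisionRule}
    (hI : ∀ x ∈ I, ∀ y ∉ I, M.stepProb μ x y = 0) (hCI : ∀ x ∈ I, x ∉ C) (n : ℕ) {x : S}
    (hx : x ∈ I) : M.hitProb μ C n x = 0 := by
  induction n generalizing x with
  | zero => simp [hitProb, hCI x hx]
  | succ n ih =>
    refine Finset.sum_eq_zero fun y _ => ?_
    by_cases hy : y ∈ I
    · rw [ih hy, mul_zero]
    · rw [hI x hx y hy, zero_mul]

lemma hitProb_le_succ {M : MDP S A AP} {C : Set S} (hC : M.IsClosedSet C) (μ : M.DecisionRule)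
    (n : ℕ) (x : S) : M.hitProb μ C n x ≤ M.hitProb μ C (n + 1) x := by
  induction n generalizing x with
  | zero =>
    by_cases hx : x ∈ C
    · rw [hitProb_of_mem hC μ _ hx, hitProb_of_mem hC μ _ hx]
    · rw [hitProb, if_neg hx]
      exact M.hitProb_nonneg _ _ _ _
  | succ n ih =>
    exact Finset.sum_le_sum fun y _ => mul_le_mul_of_nonneg_left (ih y) (M.stepProb_nonneg _ _ _)

lemma monotone_hitProb {M : MDP S A AP} {C : Set S} (hC : M.IsClosedSet C) (μ : M.DecisionRule)
    (x : S) : Monotone fun n => M.hitProb μ C n x :=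
  monotone_nat_of_le_succ fun n => hitProb_le_succ hC μ n x

lemma sum_marginal_mul_hitProb (M : MDP S A AP) (μ : M.DecisionRule) (C : Set S) (n k : ℕ) :
    ∑ x, M.marginal (fun _ => μ) n x * M.hitProb μ C k x = M.hitProb μ C (n + k) M.init := by
  induction n generalizing k with
  | zero => rw [sum_marginal_zero_mul, zero_add]
  | succ n ih => rw [sum_marginal_succ_mul, show n + 1 + k = n + (k + 1) by ring, ← ih]; rfl

/-- The probability of eventually reaching `C` under a stationary policy, as a function of the
initial state. -/
def reachVal (M : MDP S A AP) (μ : M.DecisionRule) (C : Set S) (x : S) : ℝ :=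
  ⨆ n, M.hitProb μ C n x

lemma bddAbove_hitProb (M : MDP S A AP) (μ : M.DecisionRule) (C : Set S) (x : S) :
    BddAbove (Set.range fun n => M.hitProb μ C n x) :=
  ⟨1, by rintro _ ⟨n, rfl⟩; exact M.hitProb_le_one μ C n x⟩

lemma hitProb_le_reachVal (M : MDP S A AP) (μ : M.DecisionRule) (C : Set S) (n : ℕ) (x : S) :
    M.hitProb μ C n x ≤ M.reachVal μ C x := le_ciSup (M.bddAbove_hitProb μ C x) n

lemma tendsto_hitProb {M : MDP S A AP} {C : Set S} (hC : M.IsClosedSet C) (μ : M.DecisionRule)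
    (x : S) : Tendsto (fun n => M.hitProb μ C n x) atTop (𝓝 (M.reachVal μ C x)) :=
  tendsto_atTop_ciSup (monotone_hitProb hC μ x) (M.bddAbove_hitProb μ C x)

lemma reachVal_nonneg (M : MDP S A AP) (μ : M.DecisionRule) (C : Set S) (x : S) :
    0 ≤ M.reachVal μ C x := (M.hitProb_nonneg μ C 0 x).trans (M.hitProb_le_reachVal μ C 0 x)

lemma reachVal_of_mem {M : MDP S A AP} {C : Set S} (hC : M.IsClosedSet C) (μ : M.DecisionRule)
    {x : S} (hx : x ∈ C) : M.reachVal μ C x = 1 := by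
  simp [reachVal, hitProb_of_mem hC μ _ hx]

lemma reachVal_eq_sum {M : MDP S A AP} {C : Set S} (hC : M.IsClosedSet C) (μ : M.DecisionRule)
    (x : S) : M.reachVal μ C x = ∑ y, M.stepProb μ x y * M.reachVal μ C y :=
  tendsto_nhds_unique ((tendsto_add_atTop_iff_nat 1).2 (tendsto_hitProb hC μ x))
    (tendsto_finsetSum _ fun y _ => (tendsto_hitProb hC μ y).const_mul _)

lemma reachProb_const [MeasurableSpace S] [MeasurableSingletonClass S] {M : MDP S A AP} {C : Set S}
    (hC : M.IsClosedSet C) (μ : M.DecisionRule) :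
    M.reachProb (fun _ => μ) C = M.reachVal μ C M.init := by
  classical
  refine tendsto_nhds_unique (M.tendsto_reachProb (fun _ => μ) hC) ?_
  refine (tendsto_hitProb hC μ M.init).congr fun n => ?_
  rw [← add_zero n, ← sum_marginal_mul_hitProb]
  simp [hitProb]

/-! ### Optimal reachability by discounted dynamic programming -/

open Classical in
/-- The decision rule that always chooses the action `d x` at the state `x`. -/
def DecisionRule.pure {M : MDP S A AP} (d : S → A) (hd : ∀ x, d x ∈ M.avail x) :
    M.DecisionRule where
  val s a := if a = d s then 1 else 0
  nonneg s a := by split_ifs <;> simp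
  le_one s a := by split_ifs <;> simp
  sum_eq_one s := by simp [hd s]

lemma stepProb_pure {M : MDP S A AP} (d : S → A) (hd : ∀ x, d x ∈ M.avail x) (x y : S) :
    M.stepProb (DecisionRule.pure d hd) x y = M.prob x (d x) y := by
  rw [stepProb, Finset.sum_eq_single (d x)] <;> simp +contextual [DecisionRule.pure, hd x]

lemma avail_nonempty {M : MDP S A AP} (μ : M.DecisionRule) (x : S) : (M.avail x).Nonempty := by
  by_contra h
  have := μ.sum_eq_one x
  rw [Finset.not_nonempty_iff_eq_empty.1 h] at this
  simp at this

lemma sum_stepProb_mul (M : MDP S A AP) (μ : M.DecisionRule) (x : S) (V : S → ℝ) :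
    ∑ y, M.stepProb μ x y * V y = ∑ a ∈ M.avail x, μ.val x a * ∑ y, M.prob x a y * V y := by
  simp only [stepProb, Finset.sum_mul, Finset.mul_sum]
  rw [Finset.sum_comm]
  exact Finset.sum_congr rfl fun a _ => Finset.sum_congr rfl fun y _ => by ring

/-- The optimality equation of the discounted probability of reaching a set of states. -/
lemma exists_discounted_value (M : MDP S A AP) (h : ∀ x, (M.avail x).Nonempty) (C : Set S)
    {β : ℝ} (hβ0 : 0 < β) (hβ1 : β < 1) :
    ∃ V : S → ℝ, (∀ x ∈ C, V x = 1) ∧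
      ∀ x ∉ C, V x = β * (M.avail x).sup' (h x) fun a => ∑ y, M.prob x a y * V y := by
  classical
  let T : (S → ℝ) → S → ℝ := fun V x => if x ∈ C then 1 else
    β * (M.avail x).sup' (h x) fun a => ∑ y, M.prob x a y * V y
  have key (V W : S → ℝ) (x : S) : (M.avail x).sup' (h x) (fun a => ∑ y, M.prob x a y * V y) ≤
      (M.avail x).sup' (h x) (fun a => ∑ y, M.prob x a y * W y) + dist V W := by
    refine Finset.sup'_le _ _ fun a ha => ?_
    refine le_trans ?_ (add_le_add_left (Finset.le_sup' (fun a => ∑ y, M.prob x a y * W y) ha) _)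
    have : ∑ y, M.prob x a y * dist V W = dist V W := by
      rw [← Finset.sum_mul, M.prob_sum x a ha, one_mul]
    rw [← this, ← Finset.sum_add_distrib]
    refine Finset.sum_le_sum fun y _ => ?_
    rw [← mul_add]
    refine mul_le_mul_of_nonneg_left ?_ (M.prob_nonneg _ _ _)
    have h1 := dist_le_pi_dist V W y
    rw [Real.dist_eq] at h1
    linarith [le_abs_self (V y - W y)]
  -- Discounting makes the Bellman operator a sup-norm contraction; without it the fixed point need
  -- not be unique.
  have hT : ContractingWith ⟨β, hβ0.le⟩ T := by
    refine ⟨by exact_mod_cast hβ1, LipschitzWith.of_dist_le_mul fun V W => ?_⟩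
    change dist (T V) (T W) ≤ β * dist V W
    rw [dist_pi_le_iff (by positivity)]
    intro x
    by_cases hx : x ∈ C
    · simp only [T, if_pos hx, dist_self]; positivity
    · simp only [T, if_neg hx]
      rw [Real.dist_eq, ← mul_sub, abs_mul, abs_of_pos hβ0]
      refine mul_le_mul_of_nonneg_left (abs_le.2 ⟨?_, ?_⟩) hβ0.le
      · have := key W V x
        rw [dist_comm] at this
        linarith
      · have := key V W x
        linarith
  have hfix : T (hT.fixedPoint T) = hT.fixedPoint T := hT.fixedPoint_isFixedPt
  refine ⟨hT.fixedPoint T, fun x hx => ?_, fun x hx => ?_⟩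
  · rw [← hfix]; simp [T, hx]
  · conv_lhs => rw [← hfix]
    simp [T, hx]

section Optimal

variable [MeasurableSpace S] [MeasurableSingletonClass S]

/-- Discounted reachability bounds: some deterministic stationary policy does at least as well as
`β ^ n` times any policy with horizon `n`. -/
lemma exists_pure_le_reachProb {M : MDP S A AP} {C : Set S} (hC : M.IsClosedSet C)
    [DecidablePred (· ∈ C)] (π : M.Policy) (n : ℕ) {β : ℝ} (hβ0 : 0 < β) (hβ1 : β < 1) :
    ∃ (d : S → A) (hd : ∀ x, d x ∈ M.avail x),
      β ^ n * (∑ x, if x ∈ C then M.marginal π n x else 0) ≤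
        M.reachProb (fun _ => DecisionRule.pure d hd) C := by
  have hne := avail_nonempty (π 0)
  have : Nonempty S := ⟨M.init⟩
  obtain ⟨V, hVC, hV⟩ := M.exists_discounted_value hne C hβ0 hβ1
  choose d hd hdV using fun x =>
    Finset.exists_mem_eq_sup' (hne x) fun a => ∑ y, M.prob x a y * V y
  have hVd (x : S) (hx : x ∉ C) : V x = β * ∑ y, M.prob x (d x) y * V y := by rw [hV x hx, hdV]
  have hV1 (x : S) : V x ≤ 1 := by
    obtain ⟨z, hz⟩ := Finite.exists_max V
    refine (hz x).trans ?_
    by_cases hzC : z ∈ C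
    · exact (hVC z hzC).le
    · have h1 : ∑ y, M.prob z (d z) y * V y ≤ V z := by
        calc _ ≤ ∑ y, M.prob z (d z) y * V z :=
              Finset.sum_le_sum fun y _ => mul_le_mul_of_nonneg_left (hz y) (M.prob_nonneg _ _ _)
          _ = V z := by rw [← Finset.sum_mul, M.prob_sum z _ (hd z), one_mul]
      have h2 := hVd z hzC
      nlinarith
  have hV0 (x : S) : 0 ≤ V x := by
    obtain ⟨z, hz⟩ := Finite.exists_min V
    refine le_trans ?_ (hz x)
    by_cases hzC : z ∈ C
    · rw [hVC z hzC]; exact zero_le_one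
    · have h1 : V z ≤ ∑ y, M.prob z (d z) y * V y := by
        calc V z = ∑ y, M.prob z (d z) y * V z := by
              rw [← Finset.sum_mul, M.prob_sum z _ (hd z), one_mul]
          _ ≤ _ := Finset.sum_le_sum fun y _ =>
              mul_le_mul_of_nonneg_left (hz y) (M.prob_nonneg _ _ _)
      have h2 := hVd z hzC
      nlinarith
  have hsuper (μ : M.DecisionRule) (x : S) : β * ∑ y, M.stepProb μ x y * V y ≤ V x := by
    by_cases hx : x ∈ C
    · rw [hVC x hx]
      have : ∑ y, M.stepProb μ x y * V y ≤ 1 := by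
        rw [← M.stepProb_sum μ x]
        exact Finset.sum_le_sum fun y _ =>
          mul_le_of_le_one_right (M.stepProb_nonneg _ _ _) (hV1 y)
      nlinarith
    · rw [hV x hx, sum_stepProb_mul]
      refine mul_le_mul_of_nonneg_left ?_ hβ0.le
      calc _ ≤ ∑ a ∈ M.avail x, μ.val x a *
            (M.avail x).sup' (hne x) (fun a => ∑ y, M.prob x a y * V y) :=
            Finset.sum_le_sum fun a ha => mul_le_mul_of_nonneg_left
              (Finset.le_sup' (fun a => ∑ y, M.prob x a y * V y) ha) (μ.nonneg x a)
        _ = _ := by rw [← Finset.sum_mul, μ.sum_eq_one, one_mul]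
  -- Under any policy, `β ^ n` times the expected value of `V` at time `n` does not increase.
  have hup (n : ℕ) : β ^ n * ∑ x, M.marginal π n x * V x ≤ V M.init := by
    induction n with
    | zero => rw [sum_marginal_zero_mul, pow_zero, one_mul]
    | succ n ih =>
      refine le_trans ?_ ih
      rw [sum_marginal_succ_mul, pow_succ, mul_assoc]
      refine mul_le_mul_of_nonneg_left ?_ (by positivity)
      rw [Finset.mul_sum]
      refine Finset.sum_le_sum fun x _ => ?_
      have := mul_le_mul_of_nonneg_left (hsuper (π n) x) (M.marginal_nonneg π n x)
      linarith
  -- The greedy rule attains `V` up to the discounted contribution beyond the horizon, at most `β ^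
  -- n`.
  have hlow (n : ℕ) (x : S) : V x - β ^ n ≤ M.hitProb (DecisionRule.pure d hd) C n x := by
    induction n generalizing x with
    | zero => linarith [hV1 x, M.hitProb_nonneg (DecisionRule.pure d hd) C 0 x, pow_zero β]
    | succ n ih =>
      by_cases hx : x ∈ C
      · rw [hitProb_of_mem hC _ _ hx]
        linarith [hV1 x, pow_pos hβ0 (n + 1)]
      · have h1 : ∑ y, M.prob x (d x) y * (V y - β ^ n) ≤
            M.hitProb (DecisionRule.pure d hd) C (n + 1) x := by
          rw [hitProb_succ]
          refine Finset.sum_le_sum fun y _ => ?_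
          rw [stepProb_pure]
          exact mul_le_mul_of_nonneg_left (ih y) (M.prob_nonneg _ _ _)
        have h2 : ∑ y, M.prob x (d x) y * (V y - β ^ n) =
            ∑ y, M.prob x (d x) y * V y - β ^ n := by
          simp only [mul_sub, Finset.sum_sub_distrib]
          rw [← Finset.sum_mul, M.prob_sum x _ (hd x), one_mul]
        have h3 := M.hitProb_nonneg (DecisionRule.pure d hd) C (n + 1) x
        have h4 := hVd x hx
        rw [h2] at h1
        have h5 := mul_le_mul_of_nonneg_left h1 hβ0.le
        rw [pow_succ]
        nlinarith
  refine ⟨d, hd, ?_⟩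
  calc β ^ n * (∑ x, if x ∈ C then M.marginal π n x else 0)
      ≤ β ^ n * ∑ x, M.marginal π n x * V x := by
        refine mul_le_mul_of_nonneg_left (Finset.sum_le_sum fun x _ => ?_) (by positivity)
        split_ifs with hx
        · rw [hVC x hx, mul_one]
        · exact mul_nonneg (M.marginal_nonneg π n x) (hV0 x)
    _ ≤ V M.init := hup n
    _ ≤ M.reachVal (DecisionRule.pure d hd) C M.init := by
        have h1 : Tendsto (fun n => V M.init - β ^ n) atTop (𝓝 (V M.init - 0)) :=
          (tendsto_pow_atTop_nhds_zero_of_lt_one hβ0.le hβ1).const_sub _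
        rw [sub_zero] at h1
        exact le_of_tendsto_of_tendsto' h1 (tendsto_hitProb hC _ M.init) fun n => hlow n _
    _ = _ := (reachProb_const hC _).symm

/-- Some stationary policy maximises the probability of reaching a closed set of states. -/
theorem exists_decisionRule_forall_reachProb_le [Finite A] {M : MDP S A AP} {C : Set S}
    (hC : M.IsClosedSet C) (π : M.Policy) :
    ∃ μ : M.DecisionRule, M.reachProb π C ≤ M.reachProb (fun _ => μ) C := by
  classical
  have : Nonempty {d : S → A // ∀ x, d x ∈ M.avail x} := by
    choose d hd using avail_nonempty (π 0)
    exact ⟨⟨d, hd⟩⟩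
  -- The greedy rule varies with `β`. There are only finitely many deterministic rules, so a best
  -- one serves all `β` and `n`, and both limits can be taken.
  obtain ⟨⟨d, hd⟩, hmax⟩ := Finite.exists_max fun d : {d : S → A // ∀ x, d x ∈ M.avail x} =>
    M.reachProb (fun _ => DecisionRule.pure d.1 d.2) C
  refine ⟨DecisionRule.pure d hd, le_of_tendsto' (M.tendsto_reachProb π hC) fun n => ?_⟩
  have h1 : Tendsto (fun β : ℝ => β ^ n * (∑ x, if x ∈ C then M.marginal π n x else 0)) (𝓝[<] 1)
      (𝓝 (1 ^ n * (∑ x, if x ∈ C then M.marginal π n x else 0))) :=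
    ((by fun_prop : Continuous fun β : ℝ =>
      β ^ n * (∑ x, if x ∈ C then M.marginal π n x else 0)).tendsto 1).mono_left
        nhdsWithin_le_nhds
  rw [one_pow, one_mul] at h1
  refine le_of_tendsto h1 ?_
  filter_upwards [Ioo_mem_nhdsLT (show (0 : ℝ) < 1 by norm_num)] with β hβ
  obtain ⟨e, he, h2⟩ := exists_pure_le_reachProb hC π n hβ.1 hβ.2
  exact h2.trans (hmax ⟨e, he⟩)

end Optimal

end MDP

/-! ### Stationary policies from occupation measures -/

namespace MDP

open Filter InformationTheory
open scoped Topology ENNReal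

variable {S A AP : Type*} [Fintype S]

open Classical in
/-- The decision rule that averages the rules of `π` with the weights `w t s` at the states in `G`,
and agrees with `ρ` elsewhere. -/
def DecisionRule.average {M : MDP S A AP} (π : M.Policy) (ρ : M.DecisionRule) (w : ℕ → S → ℝ)
    (hw : ∀ t s, 0 ≤ w t s) (G : Set S) (hs : ∀ s ∈ G, Summable fun t => w t s)
    (hpos : ∀ s ∈ G, 0 < ∑' t, w t s) : M.DecisionRule where
  val s a := if s ∈ G then (∑' t, w t s * (π t).val s a) / ∑' t, w t s else ρ.val s a
  nonneg s a := by
    split_ifs with h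
    · exact div_nonneg (tsum_nonneg fun t => mul_nonneg (hw t s) ((π t).nonneg s a)) (hpos s h).le
    · exact ρ.nonneg s a
  le_one s a := by
    split_ifs with h
    · rw [div_le_one (hpos s h)]
      have hle (t : ℕ) : w t s * (π t).val s a ≤ w t s :=
        mul_le_of_le_one_right (hw t s) ((π t).le_one s a)
      exact ((hs s h).of_nonneg_of_le (fun t => mul_nonneg (hw t s) ((π t).nonneg s a))
        hle).tsum_le_tsum hle (hs s h)
    · exact ρ.le_one s a
  sum_eq_one s := by
    split_ifs with h
    · have hsum (a : A) : Summable fun t => w t s * (π t).val s a :=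
        (hs s h).of_nonneg_of_le (fun t => mul_nonneg (hw t s) ((π t).nonneg s a))
          fun t => mul_le_of_le_one_right (hw t s) ((π t).le_one s a)
      rw [← Finset.sum_div, ← Summable.tsum_finsetSum fun a _ => hsum a]
      simp only [← Finset.mul_sum, (π _).sum_eq_one, mul_one]
      exact div_self (hpos s h).ne'
    · exact ρ.sum_eq_one s

section Average

variable {M : MDP S A AP} (π : M.Policy) (ρ : M.DecisionRule) (w : ℕ → S → ℝ)
  (hw : ∀ t s, 0 ≤ w t s) (G : Set S) (hs : ∀ s ∈ G, Summable fun t => w t s)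
  (hpos : ∀ s ∈ G, 0 < ∑' t, w t s)

lemma stepProb_average_of_notMem {x : S} (hx : x ∉ G) (y : S) :
    M.stepProb (DecisionRule.average π ρ w hw G hs hpos) x y = M.stepProb ρ x y := by
  simp [stepProb, DecisionRule.average, hx]

/-- The weights are chosen so that occupation time times averaged transition probability is the
total expected flow from `x` to `y`. -/
lemma hasSum_mul_stepProb_average {x : S} (hx : x ∈ G) (y : S) :
    HasSum (fun t => w t x * M.stepProb (π t) x y)
      ((∑' t, w t x) * M.stepProb (DecisionRule.average π ρ w hw G hs hpos) x y) := by
  have hsum (a : A) : Summable fun t => w t x * (π t).val x a :=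
    (hs x hx).of_nonneg_of_le (fun t => mul_nonneg (hw t x) ((π t).nonneg x a))
      fun t => mul_le_of_le_one_right (hw t x) ((π t).le_one x a)
  have h := hasSum_sum (s := M.avail x) fun a _ => (hsum a).hasSum.mul_left (M.prob x a y)
  have h1 : ∑ a ∈ M.avail x, M.prob x a y * ∑' t, w t x * (π t).val x a =
      (∑' t, w t x) * M.stepProb (DecisionRule.average π ρ w hw G hs hpos) x y := by
    rw [stepProb, Finset.mul_sum]
    refine Finset.sum_congr rfl fun a _ => ?_
    have := (hpos x hx).ne'
    simp only [DecisionRule.average, if_pos hx]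
    field_simp
  rw [h1] at h
  refine h.congr_fun fun t => ?_
  rw [stepProb, Finset.mul_sum]
  exact Finset.sum_congr rfl fun a _ => by ring

end Average

lemma stepCost_eq_zero {M : MDP S A AP} {μ ρ : M.DecisionRule} {x : S}
    (h : ∀ y, M.stepProb μ x y = M.stepProb ρ x y) : M.stepCost μ ρ x = 0 :=
  Finset.sum_eq_zero fun y _ => by rw [h, klAtom_self]

/-- Each transition from `x` to `y` is a visit to `y` one step later. -/
lemma summable_marginal_mul_stepProb {M : MDP S A AP} {π : M.Policy} (x : S) {y : S}
    (h : Summable fun t => M.marginal π t y) :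
    Summable fun t => M.marginal π t x * M.stepProb (π t) x y :=
  ((summable_nat_add_iff 1).2 h).of_nonneg_of_le
    (fun t => mul_nonneg (M.marginal_nonneg π t x) (M.stepProb_nonneg _ _ _)) fun t =>
      Finset.single_le_sum (f := fun z => M.marginal π t z * M.stepProb (π t) z y)
        (fun z _ => mul_nonneg (M.marginal_nonneg π t z) (M.stepProb_nonneg _ _ _))
        (Finset.mem_univ x)

/-- A closed set is entered at most once. -/
lemma IsClosedSet.summable_marginal_mul_stepProb {M : MDP S A AP} {C : Set S}
    (hC : M.IsClosedSet C) (π : M.Policy) {x y : S} (hx : x ∉ C) (hy : y ∈ C) :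
    Summable fun t => M.marginal π t x * M.stepProb (π t) x y := by
  classical
  let c : ℕ → ℝ := fun t => ∑ z, M.marginal π t z * if z ∈ C then 1 else 0
  have hind : ∀ z, 0 ≤ (if z ∈ C then 1 else 0 : ℝ) := fun z => by split_ifs <;> simp
  have hc0 (t : ℕ) : 0 ≤ c t :=
    Finset.sum_nonneg fun z _ => mul_nonneg (M.marginal_nonneg π t z) (hind z)
  have hc1 (t : ℕ) : c t ≤ 1 := by
    rw [← M.sum_marginal π t]
    refine Finset.sum_le_sum fun z _ => mul_le_of_le_one_right (M.marginal_nonneg π t z) ?_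
    split_ifs <;> simp
  -- Mass flowing into `C` never flows out, so the flow is bounded by the increments of the mass of
  -- `C`, which telescope.
  have hstep (t : ℕ) : M.marginal π t x * M.stepProb (π t) x y ≤ c (t + 1) - c t := by
    have h1 : c t + M.marginal π t x * M.stepProb (π t) x y = ∑ z, M.marginal π t z *
        ((if z ∈ C then 1 else 0) + if z = x then M.stepProb (π t) x y else 0) := by
      simp [c, mul_add, Finset.sum_add_distrib]
    have h2 : c (t + 1) = ∑ z, M.marginal π t z *
        ∑ v, M.stepProb (π t) z v * if v ∈ C then 1 else 0 := M.sum_marginal_succ_mul π t _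
    rw [le_sub_iff_add_le', h1, h2]
    refine Finset.sum_le_sum fun z _ => mul_le_mul_of_nonneg_left ?_ (M.marginal_nonneg π t z)
    by_cases hz : z ∈ C
    · have hzx : z ≠ x := fun h => hx (h ▸ hz)
      rw [if_pos hz, if_neg hzx, add_zero]
      refine (M.stepProb_sum (π t) z).symm.le.trans ?_
      refine Finset.sum_le_sum fun v _ => ?_
      by_cases hv : v ∈ C
      · simp [hv]
      · simp [hC.stepProb_eq_zero (π t) hz hv]
    · rw [if_neg hz, zero_add]
      split_ifs with hzx
      · subst hzx
        have := Finset.single_le_sum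
          (f := fun v => M.stepProb (π t) z v * if v ∈ C then (1 : ℝ) else 0)
          (fun v _ => mul_nonneg (M.stepProb_nonneg (π t) z v) (hind v)) (Finset.mem_univ y)
        simpa [hy] using this
      · exact Finset.sum_nonneg fun v _ => mul_nonneg (M.stepProb_nonneg _ _ _) (hind v)
  refine summable_of_sum_range_le (c := 1)
    (fun t => mul_nonneg (M.marginal_nonneg π t x) (M.stepProb_nonneg _ _ _)) fun n => ?_
  calc _ ≤ ∑ t ∈ Finset.range n, (c (t + 1) - c t) := Finset.sum_le_sum fun t _ => hstep t
    _ = c n - c 0 := Finset.sum_range_sub c n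
    _ ≤ 1 := by linarith [hc0 0, hc1 n]

/-! ### Consequences of finite divergence -/

section FiniteCost

variable {M : MDP S A AP} {π : M.Policy} {ρ : M.DecisionRule}

lemma stepProb_eq_zero_of_cost_ne_top
    (hfin : ∀ x, ∑' t, ENNReal.ofReal (M.marginal π t x) * M.stepCost (π t) ρ x ≠ ∞)
    {x y : S} (h : M.stepProb ρ x y = 0) (t : ℕ) :
    M.marginal π t x * M.stepProb (π t) x y = 0 := by
  by_contra hne
  have h1 := ENNReal.ne_top_of_tsum_ne_top (hfin x) t
  refine h1 ?_
  have h2 : M.stepCost (π t) ρ x = ∞ := by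
    rw [stepCost, ENNReal.sum_eq_top]
    exact ⟨y, Finset.mem_univ y, by rw [h, klAtom_zero_right (right_ne_zero_of_mul hne)]⟩
  rw [h2, ENNReal.mul_top]
  simpa using lt_of_le_of_ne (M.marginal_nonneg π t x) (left_ne_zero_of_mul hne).symm

/-- Under finite cost, a transition of the reference rule out of a state that is visited infinitely
often in expectation is taken infinitely often in expectation. -/
lemma stepProb_eq_zero_of_not_summable
    (hfin : ∀ x, ∑' t, ENNReal.ofReal (M.marginal π t x) * M.stepCost (π t) ρ x ≠ ∞)
    {x y : S} (hx : ¬ Summable fun t => M.marginal π t x)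
    (hxy : Summable fun t => M.marginal π t x * M.stepProb (π t) x y) :
    M.stepProb ρ x y = 0 := by
  by_contra hne
  refine hx ?_
  have hm := M.marginal_nonneg π
  have hb : 0 < M.stepProb ρ x y := lt_of_le_of_ne (M.stepProb_nonneg _ _ _) (Ne.symm hne)
  have h1 : ∑' t, ENNReal.ofReal (M.marginal π t x * M.stepProb (π t) x y) ≠ ∞ :=
    hxy.tsum_ofReal_ne_top
  have h2 : ∑' t, ENNReal.ofReal (M.marginal π t x * M.stepProb ρ x y) ≠ ∞ := by
    refine ne_top_of_le_ne_top (b := 2 * (∑' t, ENNReal.ofReal (M.marginal π t x) *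
      M.stepCost (π t) ρ x + ∑' t, ENNReal.ofReal (M.marginal π t x * M.stepProb (π t) x y)))
      (ENNReal.mul_ne_top (by simp) (ENNReal.add_ne_top.2 ⟨hfin x, h1⟩)) ?_
    rw [← ENNReal.tsum_add, ← ENNReal.tsum_mul_left]
    refine ENNReal.tsum_le_tsum fun t => ?_
    rw [ENNReal.ofReal_mul (hm t x), ENNReal.ofReal_mul (hm t x), ← mul_add, mul_left_comm]
    gcongr
    refine (ofReal_le_two_mul_klAtom_add (M.stepProb_nonneg (π t) x y) hb.le).trans ?_
    gcongr
    exact Finset.single_le_sum (f := fun y => klAtom (M.stepProb (π t) x y) (M.stepProb ρ x y))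
      (fun _ _ => zero_le) (Finset.mem_univ y)
  have h3 := ENNReal.summable_toReal h2
  simp only [ENNReal.toReal_ofReal (mul_nonneg (hm _ x) hb.le)] at h3
  exact (summable_mul_right_iff hne).1 h3

end FiniteCost

/-- The expected occupation times of a stationary policy are bounded by any solution of the balance
equations. -/
lemma sum_marginal_const_le {M : MDP S A AP} {μ : M.DecisionRule} {π : M.Policy} {F : Set S}
    (hF : ∀ x ∈ F, Summable fun t => M.marginal π t x)
    (hin : ∀ y ∉ F, ∀ x ∈ F, M.stepProb μ y x = 0)
    (havg : ∀ y ∈ F, ∀ x, HasSum (fun t => M.marginal π t y * M.stepProb (π t) y x)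
      ((∑' t, M.marginal π t y) * M.stepProb μ y x)) (n : ℕ) :
    ∀ x ∈ F, ∑ t ∈ Finset.range n, M.marginal (fun _ => μ) t x ≤ ∑' t, M.marginal π t x := by
  classical
  induction n with
  | zero =>
    intro x _
    simpa using tsum_nonneg fun t => M.marginal_nonneg π t x
  | succ n ih =>
    intro x hx
    rw [Finset.sum_range_succ', (hF x hx).tsum_eq_zero_add, add_comm]
    refine add_le_add le_rfl ?_
    -- Time `0` is common to both policies. Later visits under `μ` come from `F` only; by induction
    -- this inflow is at most the `π`-flow from `F`, a part of the whole `π`-inflow.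
    have h1 : HasSum (fun t => ∑ y, if y ∈ F then M.marginal π t y * M.stepProb (π t) y x else 0)
        (∑ y, if y ∈ F then (∑' t, M.marginal π t y) * M.stepProb μ y x else 0) := by
      refine hasSum_sum fun y _ => ?_
      split_ifs with hy
      · exact havg y hy x
      · exact hasSum_zero
    have h2 := ((summable_nat_add_iff 1).2 (hF x hx)).hasSum
    refine le_trans ?_ (hasSum_le (fun t => ?_) h1 h2)
    · simp only [marginal_succ]
      rw [Finset.sum_comm]
      refine Finset.sum_le_sum fun y _ => ?_
      rw [← Finset.sum_mul]
      split_ifs with hy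
      · exact mul_le_mul_of_nonneg_right (ih y hy) (M.stepProb_nonneg _ _ _)
      · rw [hin y hy x hx, mul_zero]
    · rw [marginal_succ]
      refine Finset.sum_le_sum fun y _ => ?_
      split_ifs
      · exact le_rfl
      · exact mul_nonneg (M.marginal_nonneg π t y) (M.stepProb_nonneg _ _ _)

/-- Two gains combine: `μ` occupies `x` no longer than `π`, and by Jensen the averaged step costs no
more than the average of the steps. -/
lemma tsum_marginal_const_mul_stepCost_le {M : MDP S A AP} {μ ρ : M.DecisionRule} {π : M.Policy}
    {x : S} (hx : Summable fun t => M.marginal π t x)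
    (hocc : ∀ n, ∑ t ∈ Finset.range n, M.marginal (fun _ => μ) t x ≤ ∑' t, M.marginal π t x)
    (havg : ∀ y, HasSum (fun t => M.marginal π t x * M.stepProb (π t) x y)
      ((∑' t, M.marginal π t x) * M.stepProb μ x y)) :
    ∑' t, ENNReal.ofReal (M.marginal (fun _ => μ) t x) * M.stepCost μ ρ x ≤
      ∑' t, ENNReal.ofReal (M.marginal π t x) * M.stepCost (π t) ρ x := by
  rw [ENNReal.tsum_mul_right]
  have h1 : ∑' t, ENNReal.ofReal (M.marginal (fun _ => μ) t x) ≤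
      ENNReal.ofReal (∑' t, M.marginal π t x) := by
    rw [ENNReal.tsum_eq_iSup_nat]
    refine iSup_le fun n => ?_
    rw [← ENNReal.ofReal_sum_of_nonneg fun t _ => M.marginal_nonneg _ t x]
    exact ENNReal.ofReal_le_ofReal (hocc n)
  refine (mul_le_mul_left h1 _).trans ?_
  rcases (tsum_nonneg fun t => M.marginal_nonneg π t x).eq_or_lt with h0 | h0
  · rw [← h0]; simp
  · simp only [stepCost, Finset.mul_sum]
    rw [Summable.tsum_finsetSum fun _ _ => ENNReal.summable]
    exact Finset.sum_le_sum fun y _ => ofReal_mul_klAtom_le_tsum (fun t => M.marginal_nonneg π t x)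
      (fun t => M.stepProb_nonneg _ _ _) (M.stepProb_nonneg _ _ _) hx.hasSum h0 (havg y)

lemma le_reachVal_of_average [MeasurableSpace S] [MeasurableSingletonClass S] {M : MDP S A AP}
    {C F I : Set S} (hC : M.IsClosedSet C) {μ : M.DecisionRule} {π : M.Policy}
    (hcover : ∀ x, x ∈ C ∨ x ∈ F ∨ x ∈ I) (hCI : ∀ x ∈ I, x ∉ C)
    (hF : ∀ x ∈ F, Summable fun t => M.marginal π t x)
    (havg : ∀ x ∈ F, ∀ y, HasSum (fun t => M.marginal π t x * M.stepProb (π t) x y)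
      ((∑' t, M.marginal π t x) * M.stepProb μ x y))
    (hIμ : ∀ x ∈ I, ∀ y ∉ I, M.stepProb μ x y = 0)
    (hIπ : ∀ x ∈ I, ∀ y ∉ I, ∀ t, M.marginal π t x * M.stepProb (π t) x y = 0) :
    M.reachProb π C ≤ M.reachVal μ C M.init := by
  classical
  set h := M.reachVal μ C with hh
  have hI0 (x : S) (hx : x ∈ I) : h x = 0 := by
    simp [hh, reachVal, hitProb_of_forall_stepProb_eq_zero hIμ hCI _ hx]
  -- The drift of `h` vanishes at each time on `C` and `I`, but on `F` only after summation over
  -- time, by harmonicity of `h` for `μ`.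
  have hsum (x : S) : HasSum (fun t => M.marginal π t x *
      (∑ y, M.stepProb (π t) x y * h y - h x)) 0 := by
    rcases hcover x with hx | hx | hx
    · convert hasSum_zero with t
      have : ∑ y, M.stepProb (π t) x y * h y = 1 := by
        rw [← M.stepProb_sum (π t) x]
        refine Finset.sum_congr rfl fun y _ => ?_
        by_cases hy : y ∈ C
        · rw [hh, reachVal_of_mem hC μ hy, mul_one]
        · rw [hC.stepProb_eq_zero (π t) hx hy, zero_mul]
      rw [this, hh, reachVal_of_mem hC μ hx, sub_self, mul_zero]
    · have h1 := (hasSum_sum (s := Finset.univ) fun y _ => (havg x hx y).mul_right (h y)).sub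
        ((hF x hx).hasSum.mul_right (h x))
      have h2 : ∑ y, (∑' t, M.marginal π t x) * M.stepProb μ x y * h y -
          (∑' t, M.marginal π t x) * h x = 0 := by
        simp only [mul_assoc, ← Finset.mul_sum]
        rw [hh, ← reachVal_eq_sum hC, sub_self]
      rw [h2] at h1
      refine h1.congr_fun fun t => ?_
      simp only [mul_sub, Finset.mul_sum, mul_assoc]
    · convert hasSum_zero with t
      rw [hI0 x hx, sub_zero, Finset.mul_sum]
      refine Finset.sum_eq_zero fun y _ => ?_
      by_cases hy : y ∈ I
      · rw [hI0 y hy]; simp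
      · rw [← mul_assoc, hIπ x hx y hy t, zero_mul]
  let u : ℕ → ℝ := fun t => ∑ x, M.marginal π t x * h x
  have hu : HasSum (fun t => u (t + 1) - u t) 0 := by
    have h1 := hasSum_sum (s := Finset.univ) fun x _ => hsum x
    rw [Finset.sum_const_zero] at h1
    refine h1.congr_fun fun t => ?_
    simp only [u, sum_marginal_succ_mul, mul_sub, Finset.sum_sub_distrib]
  have hu' : Tendsto u atTop (𝓝 (h M.init)) := by
    have h1 := hu.tendsto_sum_nat
    simp only [Finset.sum_range_sub] at h1
    have h2 := h1.add_const (u 0)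
    have h3 : u 0 = h M.init := M.sum_marginal_zero_mul π h
    simpa [h3] using h2
  refine le_of_tendsto_of_tendsto' (M.tendsto_reachProb π hC) hu' fun n => ?_
  refine Finset.sum_le_sum fun x _ => ?_
  split_ifs with hx
  · rw [hh, reachVal_of_mem hC μ hx, mul_one]
  · exact mul_nonneg (M.marginal_nonneg π n x) (M.reachVal_nonneg μ C x)

/-- For every policy there is a stationary policy that reaches the closed set `C` with at least the
same probability and whose divergence from a stationary reference policy is not larger. -/
theorem exists_stationary_reachProb_klDiv_le [Finite A] [MeasurableSpace S]
    [MeasurableSingletonClass S] {M : MDP S A AP} {C : Set S} (hC : M.IsClosedSet C)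
    (ρ : M.DecisionRule) (π : M.Policy) :
    ∃ μ : M.DecisionRule, M.reachProb π C ≤ M.reachProb (fun _ => μ) C ∧
      klDiv (M.pathDist fun _ => μ) (M.pathDist fun _ => ρ) ≤
        klDiv (M.pathDist π) (M.pathDist fun _ => ρ) := by
  by_cases htop : klDiv (M.pathDist π) (M.pathDist fun _ => ρ) = ∞
  · obtain ⟨μ, hμ⟩ := exists_decisionRule_forall_reachProb_le hC π
    exact ⟨μ, hμ, le_top.trans_eq htop.symm⟩
  rw [klDiv_pathDist, Summable.tsum_finsetSum fun _ _ => ENNReal.summable] at htop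
  have hfin : ∀ x, ∑' t, ENNReal.ofReal (M.marginal π t x) * M.stepCost (π t) ρ x ≠ ∞ :=
    fun x => (ENNReal.sum_ne_top.1 htop) x (Finset.mem_univ x)
  let F : Set S := {x | x ∉ C ∧ Summable fun t => M.marginal π t x}
  let I : Set S := {x | x ∉ C ∧ ¬ Summable fun t => M.marginal π t x}
  let G : Set S := {x | x ∈ F ∧ 0 < ∑' t, M.marginal π t x}
  let μ : M.DecisionRule := DecisionRule.average π ρ (M.marginal π) (M.marginal_nonneg π) G
    (fun x hx => hx.1.2) fun x hx => hx.2
  have hμ : ∀ x ∉ F, ∀ y, M.stepProb μ x y = M.stepProb ρ x y := fun x hx y =>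
    stepProb_average_of_notMem π ρ _ _ G _ _ (fun h => hx h.1) y
  have havg : ∀ x ∈ F, ∀ y, HasSum (fun t => M.marginal π t x * M.stepProb (π t) x y)
      ((∑' t, M.marginal π t x) * M.stepProb μ x y) := by
    intro x hx y
    rcases (tsum_nonneg fun t => M.marginal_nonneg π t x).eq_or_lt with h0 | h0
    · have h1 := hx.2.hasSum
      rw [← h0, hasSum_zero_iff_of_nonneg fun t => M.marginal_nonneg π t x] at h1
      rw [← h0, zero_mul]
      convert hasSum_zero with t
      rw [show M.marginal π t x = 0 from congrFun h1 t, zero_mul]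
    · exact hasSum_mul_stepProb_average π ρ _ _ G _ _ ⟨hx, h0⟩ y
  -- Flow out of `I` goes to `C`, entered at most once, or to `F`, visited finitely often in
  -- expectation; so it is summable.
  have hIρ : ∀ x ∈ I, ∀ y ∉ I, M.stepProb ρ x y = 0 := by
    intro x hx y hy
    refine stepProb_eq_zero_of_not_summable hfin hx.2 ?_
    by_cases hyC : y ∈ C
    · exact hC.summable_marginal_mul_stepProb π hx.1 hyC
    · exact summable_marginal_mul_stepProb x (by_contra fun h => hy ⟨hyC, h⟩)
  have hIF : ∀ x ∈ I, x ∉ F := fun x hx h => hx.2 h.2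
  have hcover (x : S) : x ∈ C ∨ x ∈ F ∨ x ∈ I := by
    by_cases hx : x ∈ C
    · exact Or.inl hx
    · by_cases hs : Summable fun t => M.marginal π t x
      · exact Or.inr (Or.inl ⟨hx, hs⟩)
      · exact Or.inr (Or.inr ⟨hx, hs⟩)
  refine ⟨μ, ?_, ?_⟩
  · rw [reachProb_const hC]
    refine le_reachVal_of_average hC hcover (fun x hx => hx.1) (fun x hx => hx.2) havg ?_ ?_
    · exact fun x hx y hy => by rw [hμ x (hIF x hx), hIρ x hx y hy]
    · exact fun x hx y hy t => stepProb_eq_zero_of_cost_ne_top hfin (hIρ x hx y hy) t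
  · have hin : ∀ y ∉ F, ∀ x ∈ F, M.stepProb μ y x = 0 := by
      intro y hy x hx
      rcases hcover y with h | h | h
      · exact hC.stepProb_eq_zero μ h hx.1
      · exact absurd h hy
      · rw [hμ y hy, hIρ y h x fun h' => hIF x h' hx]
    rw [klDiv_pathDist, klDiv_pathDist, Summable.tsum_finsetSum fun _ _ => ENNReal.summable,
      Summable.tsum_finsetSum fun _ _ => ENNReal.summable]
    refine Finset.sum_le_sum fun x _ => ?_
    by_cases hx : x ∈ F
    · exact tsum_marginal_const_mul_stepCost_le hx.2
        (fun n => sum_marginal_const_le (fun x hx => hx.2) hin havg n x hx) (havg x hx)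
    -- Outside `F` the rule is `ρ` itself, so an infinite occupation time is multiplied by zero
    -- cost.
    · simp [stepCost_eq_zero (hμ x hx)]

/-- Acceptance by the agent's automaton is permanent along the paths of the product. -/
lemma exists_isClosedSet_agentSet {QS QA : Type*} [Fintype QS] [Fintype QA] (M : MDP S A AP)
    (DS : DFA (Set AP) QS) (DA : DFA (Set AP) QA) (hperm : DA.AcceptsPermanently) :
    ∃ G : Set (S × QS × QA), (M.product (DS.pairing DA)).IsClosedSet G ∧
      (M.product (DS.pairing DA)).init ∈ G ∧
      (M.product (DS.pairing DA)).IsClosedSet (agentSet S DA ∩ G) := by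
  have hstep (p : S × QS × QA) (a : A) (q : S × QS × QA)
      (h : (M.product (DS.pairing DA)).prob p a q ≠ 0) :
      q.2.2 = DA.step p.2.2 (M.label q.1) := by
    by_contra hne
    refine h (if_neg fun h' => hne ?_)
    rw [h']
    rfl
  -- Permanence says nothing about automaton states that no word reaches, so these are excluded.
  refine ⟨{p | ∃ u, DA.eval u = p.2.2}, ?_, ⟨[M.label M.init], by
    rw [DFA.eval_singleton]; rfl⟩, ?_⟩
  · rintro p ⟨u, hu⟩ a _ q hq
    by_contra hne
    refine hq ⟨u ++ [M.label q.1], ?_⟩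
    rw [DFA.eval_append_singleton, hu, hstep p a q hne]
  · rintro p ⟨hp, u, hu⟩ a _ q hq
    by_contra hne
    have h1 : DA.eval (u ++ [M.label q.1]) = q.2.2 := by
      rw [DFA.eval_append_singleton, hu, hstep p a q hne]
    refine hq ⟨?_, u ++ [M.label q.1], h1⟩
    change q.2.2 ∈ DA.accept
    rw [← h1]
    exact hperm u _ (by rw [hu]; exact hp)

end MDP

end

theorem mainTheorem2 {S A AP QS QA : Type*} [Fintype S] [Finite A] [Finite AP]
    [Fintype QS] [Fintype QA]
    [MeasurableSpace S] [MeasurableSingletonClass S]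
    [MeasurableSpace QS] [MeasurableSingletonClass QS]
    [MeasurableSpace QA] [MeasurableSingletonClass QA]
    (M : MDP S A AP) (φS φA : LTL AP) (hφS : φS.IsCoSafe) (hφA : φA.IsCoSafe)
    (DS : DFA (Set AP) QS) (DA : DFA (Set AP) QA)
    (hDS : DS.Represents φS) (hDA : DA.Represents φA) (hperm : DA.AcceptsPermanently)
    (πS : (M.product (DS.pairing DA)).Policy)
    (hπS : (M.product (DS.pairing DA)).IsStationary πS)
    (ν : ℝ) (πA : (M.product (DS.pairing DA)).Policy)
    (hπA : ν ≤ (M.product (DS.pairing DA)).reachProb πA (MDP.agentSet S DA)) :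
    ∃ πSt : (M.product (DS.pairing DA)).Policy,
      (M.product (DS.pairing DA)).IsStationary πSt ∧
      ν ≤ (M.product (DS.pairing DA)).reachProb πSt (MDP.agentSet S DA) ∧
      InformationTheory.klDiv ((M.product (DS.pairing DA)).pathDist πSt)
          ((M.product (DS.pairing DA)).pathDist πS) ≤
        InformationTheory.klDiv ((M.product (DS.pairing DA)).pathDist πA)
          ((M.product (DS.pairing DA)).pathDist πS) := by 
  obtain ⟨ρ, hρ⟩ := hπS
  obtain rfl : πS = fun _ => ρ := funext hρ
  obtain ⟨G, hG, hG0, hCG⟩ := MDP.exists_isClosedSet_agentSet M DS DA hperm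
  obtain ⟨μ, hreach, hkl⟩ := MDP.exists_stationary_reachProb_klDiv_le hCG ρ πA
  rw [MDP.reachProb_inter _ _ hG hG0, MDP.reachProb_inter _ _ hG hG0] at hreach
  exact ⟨fun _ => μ, ⟨μ, fun _ => rfl⟩, hπA.trans hreach, hkl⟩
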